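/- Let $N$ be an $n$-dimensional smooth manifold and let $F$ be the Randers metric on $N$ with navigation data $(h,W)$, i.e. $h$ is a smooth Riemannian metric, $W$ is a smooth vector field with $\|W\|_h<1$, and $$F(y)=\frac{\sqrt{\lambda\,h(y,y)+h(W,y)^2}-h(W,y)}{\lambda},\qquad \lambda=1-\|W\|_h^2 .$$ In local coordinates $(x,y)$ of $TN$ put $g_{ij}=\frac12[F^2]_{y^iy^j}$, $(g^{ij})=(g_{ij})^{-1}$ and $g_w(u,v)=g_{ij}(x,w)u^iv^j$; let $G^i=\frac14 g^{il}\{[F^2]_{x^ky^l}y^k-[F^2]_{x^l}\}$ be the geodesic coefficients and $\Gamma^k_{ij}=\frac{\partial^2G^k}{\partial y^i\partial y^j}$ the coefficients of the Berwald connection. Let $D^w_vX=\{v^j\partial_{x^j}X^i+\Gamma^i_{jk}(w)v^jX^k\}\frac{\partial}{\partial x^i}$ be the covariant derivative with reference vector $w\neq0$. Let $\sigma(x)=\mathrm{vol}(B^n(1))/\mathrm{vol}\{y\in\mathbb R^n: F(x,y)<1\}$ be the density of the Busemann–Hausdorff volume form $d\mu_{BH}=\sigma\,dx^1\wedge\dots\wedge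 dx^n$. The $\mathbf S$-curvature of $(N,F,d\mu_{BH})$ is $$S(x,y)=\frac{\partial G^i}{\partial y^i}-y^i\frac{\partial\ln\sigma}{\partial x^i},\qquad y\ne0 .$$ Let $F^*(\xi)=\sup\{\xi(y):F(y)=1\}$ be the dual metric, $\mathcal L(y)=F(y)[F]_{y^i}(y)\,dx^i$ the Legendre transformation, and $\mathcal L^{-1}(\xi)=F^*(\xi)[F^*]_{\xi_i}(\xi)\frac{\partial}{\partial x^i}$ its inverse. For a vector $\eta$ with $F(\eta)=1$ put $\eta_-=\mathcal L^{-1}(-\mathcal L\eta)/F^*(-\mathcal L\eta)$. Then: 1. the $\mathbf S$-curvature of $(N,F,d\mu_{BH})$ vanishes identically if and only if $W$ is a Killing field of $h$ (that is, $L_Wh=0$); 2. if the $\mathbf S$-curvature vanishes identically (equivalently, $W$ is a Killing field), then the reversible torsion of $F$ vanishes: for every $x\in N$, every differentiable vector field $\eta$ on a neighbourhood of $x$ with $F(\eta)=1$, and every $X\in T_xN$ with $g_\eta(\eta,X)=0$, $$T_\eta(X):=D^{\eta}_X\eta+D^{\eta_-}_X\eta_-=0\quad\text{at }x .$$ -/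

import Mathlib

open scoped Manifold ContDiff Bundle

noncomputable section

namespace Finsler

/-- Coordinate space `ℝⁿ`. -/
abbrev E (n : ℕ) : Type := EuclideanSpace ℝ (Fin n)

/-! ### Finsler geometry in local coordinates

Below, `F : E n → E n → ℝ` is the coordinate expression `(x, y) ↦ F(x, y)` of a Finsler metric,
`x` being the base point and `y` the components of a tangent vector. -/

/-- The partial derivative `∂φ/∂aⁱ`. -/
def pd {n : ℕ} (i : Fin n) (φ : E n → ℝ) (a : E n) : ℝ :=
  fderiv ℝ φ a (EuclideanSpace.single i 1)

/-- `g_{ij}(x, y) = ½ [F²]_{yⁱ yʲ}`. -/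
def fundMatrix {n : ℕ} (F : E n → E n → ℝ) (x y : E n) : Matrix (Fin n) (Fin n) ℝ :=
  Matrix.of fun i j => (1 / 2 : ℝ) * pd j (fun y' => pd i (fun y'' => F x y'' ^ 2) y') y

/-- `g_w(u, v) = g_{ij}(x, w) uⁱ vʲ`. -/
def fundForm {n : ℕ} (F : E n → E n → ℝ) (x w u v : E n) : ℝ :=
  ∑ i, ∑ j, fundMatrix F x w i j * u i * v j

/-- The geodesic coefficients `Gⁱ = ¼ gⁱˡ ([F²]_{xᵏ yˡ} yᵏ - [F²]_{xˡ})`. -/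
def geodesicCoeff {n : ℕ} (F : E n → E n → ℝ) (x y : E n) (i : Fin n) : ℝ :=
  (1 / 4 : ℝ) * ∑ l, (fundMatrix F x y)⁻¹ i l *
    ((∑ k, pd k (fun x' => pd l (fun y' => F x' y' ^ 2) y) x * y k)
      - pd l (fun x' => F x' y ^ 2) x)

/-- The Berwald connection coefficients `Γᵏ_{ij} = ∂²Gᵏ/∂yⁱ∂yʲ`. -/
def berwaldCoeff {n : ℕ} (F : E n → E n → ℝ) (x y : E n) (k i j : Fin n) : ℝ :=
  pd i (fun y' => pd j (fun y'' => geodesicCoeff F x y'' k) y') y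

/-- The components of the covariant derivative `D^w_v X` at `x`, with reference vector `w`:
`vʲ ∂Xⁱ/∂xʲ + Γⁱ_{jk}(w) vʲ Xᵏ`. -/
def covDeriv {n : ℕ} (F : E n → E n → ℝ) (x w v : E n) (X : E n → E n) : E n :=
  WithLp.toLp 2 fun i =>
    (∑ j, v j * pd j (fun x' => X x' i) x)
      + ∑ j, ∑ k, berwaldCoeff F x w i j k * v j * X x k

/-- The dual metric `F*(ξ) = sup {ξ(y) | F(y) = 1}` of the covector with components `ξ`. -/
def dualMetric {n : ℕ} (F : E n → E n → ℝ) (x ξ : E n) : ℝ :=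
  sSup ((fun y : E n => ∑ i, ξ i * y i) '' {y | F x y = 1})

/-- The Legendre transformation `ℒ(y) = F(y) [F]_{yⁱ}(y) dxⁱ` (which is `0` at `y = 0`, as
`F(0) = 0`). -/
def legendre {n : ℕ} (F : E n → E n → ℝ) (x y : E n) : E n :=
  WithLp.toLp 2 fun i => F x y * pd i (fun y' => F x y') y

/-- The inverse Legendre transformation `ℒ⁻¹(ξ) = F*(ξ) [F*]_{ξᵢ}(ξ) ∂/∂xⁱ` (which is `0` at
`ξ = 0`, as `F*(0) = 0`). -/
def legendreInv {n : ℕ} (F : E n → E n → ℝ) (x ξ : E n) : E n :=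
  WithLp.toLp 2 fun i => dualMetric F x ξ * pd i (fun ξ' => dualMetric F x ξ') ξ

/-- `η₋ = ℒ⁻¹(-ℒη) / F*(-ℒη)`. -/
def reverseVector {n : ℕ} (F : E n → E n → ℝ) (x η : E n) : E n :=
  (dualMetric F x (-legendre F x η))⁻¹ • legendreInv F x (-legendre F x η)

/-- The reversible torsion `T_η(X) = D^η_X η + D^{η₋}_X η₋` at `x`, where `η` is a vector field
and `X` is a vector at `x`. -/
def reversibleTorsion {n : ℕ} (F : E n → E n → ℝ) (η : E n → E n) (x X : E n) : E n :=
  covDeriv F x (η x) X η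
    + covDeriv F x (reverseVector F x (η x)) X (fun x' => reverseVector F x' (η x'))

/-- The density `σ` of the Busemann-Hausdorff volume form `σ dx¹ ∧ ⋯ ∧ dxⁿ`:
`σ(x) = vol(Bⁿ(1)) / vol {y ∈ ℝⁿ | F(x, y) < 1}`. -/
def bhDensity {n : ℕ} (F : E n → E n → ℝ) (x : E n) : ℝ :=
  (MeasureTheory.volume (Metric.ball (0 : E n) 1)).toReal
    / (MeasureTheory.volume {y : E n | F x y < 1}).toReal

/-- The S-curvature with respect to the volume form `σ dx¹ ∧ ⋯ ∧ dxⁿ`: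
`S(x, y) = ∂Gⁱ/∂yⁱ - yⁱ ∂(ln σ)/∂xⁱ`. -/
def sCurvature {n : ℕ} (F : E n → E n → ℝ) (σ : E n → ℝ) (x y : E n) : ℝ :=
  (∑ i, pd i (fun y' => geodesicCoeff F x y' i) y)
    - ∑ i, y i * pd i (fun x' => Real.log (σ x')) x

/-! ### Manifolds -/

section Manifold

variable {n : ℕ} {M : Type*} [TopologicalSpace M] [ChartedSpace (E n) M]
  [IsManifold (𝓡 n) ∞ M]

/-- The vector of `T_xM`, where `x = e⁻¹(u)`, whose components in the chart `e` are `y`. -/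
def ofCoord (e : OpenPartialHomeomorph M (E n)) (u y : E n) :
    TangentSpace (𝓡 n) (e.symm u) :=
  mfderiv (𝓡 n) (𝓡 n) e.symm u y

/-- The components in the chart `e` of a tangent vector `X ∈ T_xM`. -/
def toCoord (e : OpenPartialHomeomorph M (E n)) (x : M) (X : TangentSpace (𝓡 n) x) : E n :=
  mfderiv (𝓡 n) (𝓡 n) e x X

/-- The coordinate expression in the chart `e` of a function on the tangent bundle. -/
def localMetric (F : ∀ x : M, TangentSpace (𝓡 n) x → ℝ) (e : OpenPartialHomeomorph M (E n))
    (u y : E n) : ℝ :=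
  F (e.symm u) (ofCoord e u y)

/-- The coordinate expression in the chart `e` of a vector field. -/
def localField (V : ∀ x : M, TangentSpace (𝓡 n) x) (e : OpenPartialHomeomorph M (E n))
    (u : E n) : E n :=
  toCoord e (e.symm u) (V (e.symm u))

/-- The S-curvature of `F` with respect to the Busemann-Hausdorff volume form vanishes at all
`(x, y)` with `y ≠ 0`. It is computed in local coordinates, for every smooth chart. -/
def SCurvatureVanishes (F : ∀ x : M, TangentSpace (𝓡 n) x → ℝ) : Prop :=
  ∀ e ∈ IsManifold.maximalAtlas (𝓡 n) ∞ M, ∀ x ∈ e.source, ∀ y : TangentSpace (𝓡 n) x, y ≠ 0 →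
    sCurvature (localMetric F e) (bhDensity (localMetric F e)) (e x) (toCoord e x y) = 0

/-- The reversible torsion of `F` vanishes: `T_η(X) = 0` for every point `x`, every
differentiable vector field `η` with `F(η) = 1` defined on an open neighbourhood `U` of `x`
(values outside `U` are irrelevant), and every `X ∈ T_xM` with `g_η(η, X) = 0`. It is computed
in local coordinates, for every smooth chart around `x`. -/
def ReversibleTorsionVanishes (F : ∀ x : M, TangentSpace (𝓡 n) x → ℝ) : Prop :=
  ∀ (x : M) (U : Set M), IsOpen U → x ∈ U → ∀ η : ∀ z : M, TangentSpace (𝓡 n) z,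
    MDifferentiableOn (𝓡 n) (𝓡 n).tangent (fun z => (⟨z, η z⟩ : TangentBundle (𝓡 n) M)) U →
    (∀ z ∈ U, F z (η z) = 1) →
    ∀ e ∈ IsManifold.maximalAtlas (𝓡 n) ∞ M, x ∈ e.source →
    ∀ X : TangentSpace (𝓡 n) x,
      fundForm (localMetric F e) (e x) (toCoord e x (η x)) (toCoord e x (η x))
        (toCoord e x X) = 0 →
      reversibleTorsion (localMetric F e) (localField η e) (e x) (toCoord e x X) = 0

variable (n M) in
/-- Navigation data `(h, W)` on `M`: a smooth Riemannian metric `h` and a smooth vector field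
`W` with `‖W‖_h < 1`. -/
structure NavigationData where
  h : Bundle.ContMDiffRiemannianMetric (𝓡 n) ∞ (E n) (fun x : M => TangentSpace (𝓡 n) x)
  W : ∀ x : M, TangentSpace (𝓡 n) x
  smooth_W : ContMDiff (𝓡 n) (𝓡 n).tangent ∞ (fun x => (⟨x, W x⟩ : TangentBundle (𝓡 n) M))
  norm_W_lt : ∀ x, h.inner x (W x) (W x) < 1

/-- The Randers metric with navigation data `(h, W)`:
`F(y) = (√(λ h(y, y) + h(W, y)²) - h(W, y)) / λ` with `λ = 1 - ‖W‖_h²`. -/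
def NavigationData.randers (D : NavigationData n M) (x : M) (y : TangentSpace (𝓡 n) x) : ℝ :=
  (Real.sqrt ((1 - D.h.inner x (D.W x) (D.W x)) * D.h.inner x y y + D.h.inner x (D.W x) y ^ 2)
      - D.h.inner x (D.W x) y) / (1 - D.h.inner x (D.W x) (D.W x))

/-- The components `h_{ij}` of a Riemannian metric in the chart `e`. -/
def localRiem
    (h : Bundle.ContMDiffRiemannianMetric (𝓡 n) ∞ (E n) (fun x : M => TangentSpace (𝓡 n) x))
    (e : OpenPartialHomeomorph M (E n)) (i j : Fin n) (u : E n) : ℝ :=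
  h.inner (e.symm u) (ofCoord e u (EuclideanSpace.single i 1))
    (ofCoord e u (EuclideanSpace.single j 1))

/-- `W` is a Killing field of `h`: the Lie derivative `L_W h` vanishes, that is,
`Wᵏ ∂_k h_{ij} + h_{kj} ∂_i Wᵏ + h_{ik} ∂_j Wᵏ = 0` in every smooth chart. -/
def IsKilling
    (h : Bundle.ContMDiffRiemannianMetric (𝓡 n) ∞ (E n) (fun x : M => TangentSpace (𝓡 n) x))
    (W : ∀ x : M, TangentSpace (𝓡 n) x) : Prop :=
  ∀ e ∈ IsManifold.maximalAtlas (𝓡 n) ∞ M, ∀ u ∈ e.target, ∀ i j : Fin n,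
    ∑ k, (localField W e u k * pd k (localRiem h e i j) u
      + localRiem h e k j u * pd i (fun u' => localField W e u' k) u
      + localRiem h e i k u * pd j (fun u' => localField W e u' k) u) = 0

end Manifold

end Finsler

end

/-!
Zermelo navigation linearises the Randers metric. With navigation data `(b, w)` the norm
`F(y) = navNorm b w y` is the positive solution of `|y - F w|² = F²`, where `|·|` is the norm of
`b`. Everything is therefore expressed through the vector `u = y - F w` (`navRel`), which satisfies
`|u| = F`, and the positive quantity `D = F + b(u, w)` (`navDisc`), by which implicit
differentiation divides. The derivative of the wind enters through the Lie derivative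
`L = L_w b` of the metric (`navLie`) and the scalar `c = L(u, u) / (2F)` (`navCoeff`).

* The geodesic coefficients are given by the explicit spray
  `G = -½ (F ∇w(y) + c u + b⁻¹(force))` (`navSpray`), whose force term is linear in the first
  derivatives of `b` and `w`. This is not found by inverting `g_{ij}`: the vector `G` is checked to
  satisfy the Euler–Lagrange equation `d(F F_y)(y, -2G) = F F_x` (`NavAt.momentum_spray`), which
  determines it because the fundamental matrix is nondegenerate (`NavAt.momentum_nondegenerate`).
* The fibre divergence of `G` is `½ tr_b (∂_y b) - (n + 1)/2 · c` (`IsNav.sum_pd_navSpray`). The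
  unit ball of `F` is the unit ball of `b` translated by `w`, so that the Busemann–Hausdorff density
  is `√det b` (`IsNav.bhDensity_eq`), and the derivative of its logarithm along `y` is the same
  trace. Hence `S = -(n + 1)/2 · c` (`NavAt.sCurvature_eq`). Every nonzero vector `u` occurs as
  `y - F(y) w`, so by polarisation `S` vanishes at a point exactly when `L` does
  (`IsNav.navCoeff_eq_zero_iff`).
* The dual metric is `F*(ξ) = |ξ| + ξ(w)`, whence `η₋ = 2w - η` when `F(η) = 1`
  (`IsNav.reverseVector_eq`): passing from `η` to `η₋` keeps `F = 1` and changes the sign of `u`.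
  The condition `g_η(η, X) = 0` says `b(u, X) = 0`, so that `F` is stationary along `X` at both
  vectors. If moreover `L = 0`, then `c = 0` and in the sum of the two covariant derivatives all
  terms which are odd in `u` cancel; what is left pairs with a vector `z` to `L(X, z) = 0`
  (`NavAt.reversibleTorsion_eq_zero`).

In a chart the pair `(b, w)` consists of the components of `h` and `W`, which are differentiable
functions of the base point; only their first derivatives are used.
-/

noncomputable section

namespace Finsler

set_option synthInstance.maxHeartbeats 200000

/-! ### Randers norms from navigation data -/

section Norm

variable {V : Type*} [NormedAddCommGroup V] [NormedSpace ℝ V]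

/-- With this instance and the next one, derivatives of fields of bilinear forms are elaborated
with one additive structure on the space of forms, the one of the operator norm. -/
instance instNormedAddCommGroupBilin : NormedAddCommGroup (V →L[ℝ] V →L[ℝ] ℝ) :=
  ContinuousLinearMap.toNormedAddCommGroup

instance instAddCommGroupBilin : AddCommGroup (V →L[ℝ] V →L[ℝ] ℝ) :=
  NormedAddCommGroup.toAddCommGroup

/-- Pointwise navigation data: `b` is an inner product and `b w w < 1`. -/
structure IsNav (b : V →L[ℝ] V →L[ℝ] ℝ) (w : V) : Prop where
  symm : ∀ v z, b v z = b z v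
  pos : ∀ v, v ≠ 0 → 0 < b v v
  lt_one : b w w < 1

/-- The square root in the Randers norm of navigation data `(b, w)`. It is also the factor `F +
b(u, w)` by which implicit differentiation of `b u u = F ^ 2` divides (`IsNav.navDisc_eq`). -/
def navDisc (b : V →L[ℝ] V →L[ℝ] ℝ) (w y : V) : ℝ :=
  √((1 - b w w) * b y y + b w y ^ 2)

/-- The Randers norm of navigation data `(b, w)`. -/
def navNorm (b : V →L[ℝ] V →L[ℝ] ℝ) (w y : V) : ℝ :=
  (navDisc b w y - b w y) / (1 - b w w)

/-- The velocity relative to the wind, `u = y - F(y) w`, which satisfies `b u u = F(y) ^ 2`. -/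
def navRel (b : V →L[ℝ] V →L[ℝ] ℝ) (w y : V) : V :=
  y - navNorm b w y • w

section Pointwise

variable {b : V →L[ℝ] V →L[ℝ] ℝ} {w : V}

theorem IsNav.nonneg (hb : IsNav b w) (v : V) : 0 ≤ b v v := by
  by_cases h : v = 0
  · simp [h]
  · exact (hb.pos v h).le

/-- The Cauchy–Schwarz inequality. -/
theorem IsNav.sq_le (hb : IsNav b w) (v z : V) : b v z ^ 2 ≤ b v v * b z z := by
  by_cases h : z = 0
  · simp [h]
  have hz := hb.pos z h
  have h1 := hb.nonneg (b z z • v - b v z • z)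
  have h2 : b (b z z • v - b v z • z) (b z z • v - b v z • z)
      = b z z * (b v v * b z z - b v z ^ 2) := by
    simp only [map_sub, map_smul, sub_apply, smul_apply,
      smul_eq_mul, hb.symm z v]
    ring
  rw [h2] at h1
  have := nonneg_of_mul_nonneg_right h1 hz
  linarith

theorem IsNav.lam_pos (hb : IsNav b w) : 0 < 1 - b w w := by linarith [hb.lt_one]

theorem IsNav.radicand_pos (hb : IsNav b w) {y : V} (hy : y ≠ 0) :
    0 < (1 - b w w) * b y y + b w y ^ 2 := by
  have := mul_pos hb.lam_pos (hb.pos y hy)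
  positivity

theorem IsNav.navDisc_sq (hb : IsNav b w) (y : V) :
    navDisc b w y ^ 2 = (1 - b w w) * b y y + b w y ^ 2 := by
  have := mul_nonneg hb.lam_pos.le (hb.nonneg y)
  exact Real.sq_sqrt (by positivity)

theorem IsNav.navDisc_pos (hb : IsNav b w) {y : V} (hy : y ≠ 0) : 0 < navDisc b w y :=
  Real.sqrt_pos.2 (hb.radicand_pos hy)

theorem IsNav.abs_le_navDisc (hb : IsNav b w) (y : V) : |b w y| ≤ navDisc b w y := by
  apply Real.abs_le_sqrt
  have := mul_nonneg hb.lam_pos.le (hb.nonneg y)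
  linarith

theorem IsNav.navNorm_pos (hb : IsNav b w) {y : V} (hy : y ≠ 0) : 0 < navNorm b w y := by
  refine div_pos ?_ hb.lam_pos
  have h : |b w y| < navDisc b w y := by
    apply lt_of_pow_lt_pow_left₀ 2 (hb.navDisc_pos hy).le
    rw [hb.navDisc_sq, sq_abs]
    linarith [mul_pos hb.lam_pos (hb.pos y hy)]
  linarith [le_abs_self (b w y)]

theorem IsNav.lam_mul_navNorm (hb : IsNav b w) (y : V) :
    (1 - b w w) * navNorm b w y = navDisc b w y - b w y :=
  mul_div_cancel₀ _ hb.lam_pos.ne'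

theorem IsNav.navDisc_eq (hb : IsNav b w) (y : V) :
    navDisc b w y = navNorm b w y + b (navRel b w y) w := by
  rw [navRel, map_sub, map_smul, sub_apply, smul_apply,
    smul_eq_mul, hb.symm y w]
  linarith [hb.lam_mul_navNorm y]

/-- The quadratic polynomial in `f` whose positive root is the Randers norm, factorised. -/
theorem IsNav.quadratic (hb : IsNav b w) (y : V) (f : ℝ) :
    b (y - f • w) (y - f • w) - f ^ 2
      = (navNorm b w y - f) * ((1 - b w w) * f + (b w y + navDisc b w y)) := by
  have h1 := hb.lam_mul_navNorm y
  have h2 := hb.navDisc_sq y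
  have h3 := hb.lam_pos.ne'
  simp only [map_sub, map_smul, sub_apply, smul_apply,
      smul_eq_mul, hb.symm y w]
  apply mul_left_cancel₀ h3
  linear_combination (-(1 - b w w) * f - (b w y + navDisc b w y)) * h1 - h2

theorem IsNav.navRel_sq (hb : IsNav b w) (y : V) :
    b (navRel b w y) (navRel b w y) = navNorm b w y ^ 2 := by
  have := hb.quadratic y (navNorm b w y)
  rw [sub_self, zero_mul] at this
  exact sub_eq_zero.1 this

theorem IsNav.quadratic_factor_pos (hb : IsNav b w) (y : V) {f : ℝ} (hf : 0 < f) :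
    0 < (1 - b w w) * f + (b w y + navDisc b w y) := by
  have := mul_pos hb.lam_pos hf
  linarith [hb.abs_le_navDisc y, neg_abs_le (b w y)]

theorem IsNav.navNorm_eq_iff (hb : IsNav b w) (y : V) {f : ℝ} (hf : 0 < f) :
    navNorm b w y = f ↔ b (y - f • w) (y - f • w) = f ^ 2 := by
  have h1 := hb.quadratic y f
  have h2 := hb.quadratic_factor_pos y hf
  rw [← sub_eq_zero, ← sub_eq_zero (b := f ^ 2), h1, mul_eq_zero, or_iff_left h2.ne']

/-- The unit ball of the Randers norm is the unit ball of `b` translated by `w`. -/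
theorem IsNav.navNorm_lt_one_iff (hb : IsNav b w) (y : V) :
    navNorm b w y < 1 ↔ b (y - w) (y - w) < 1 := by
  have h1 := hb.quadratic y 1
  have h2 := hb.quadratic_factor_pos y one_pos
  rw [one_smul, one_pow] at h1
  rw [← sub_neg, ← sub_neg (b := (1 : ℝ)), h1, mul_neg_iff]
  constructor
  · intro h; exact Or.inr ⟨h, h2⟩
  · rintro (h | h)
    · linarith [h.2]
    · exact h.1

theorem IsNav.navNorm_eq_one_iff (hb : IsNav b w) (y : V) :
    navNorm b w y = 1 ↔ b (y - w) (y - w) = 1 := by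
  simpa using hb.navNorm_eq_iff y one_pos

theorem IsNav.navRel_ne_zero (hb : IsNav b w) {y : V} (hy : y ≠ 0) : navRel b w y ≠ 0 := by
  intro h
  have h1 := hb.navRel_sq y
  rw [h] at h1
  have h2 := hb.navNorm_pos hy
  simp at h1
  nlinarith

theorem navNorm_zero : navNorm b w 0 = 0 := by simp [navNorm, navDisc]

theorem ne_zero_of_navNorm_ne_zero {y : V} (h : navNorm b w y ≠ 0) : y ≠ 0 := by
  rintro rfl; exact h navNorm_zero

theorem IsNav.navNorm_smul (hb : IsNav b w) {t : ℝ} (ht : 0 < t) (y : V) :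
    navNorm b w (t • y) = t * navNorm b w y := by
  by_cases hy : y = 0
  · simp [hy, navNorm_zero]
  rw [hb.navNorm_eq_iff _ (mul_pos ht (hb.navNorm_pos hy)), mul_smul, ← smul_sub]
  have := hb.navRel_sq y
  rw [navRel] at this
  simp only [map_smul, smul_apply, smul_eq_mul, this]
  ring

theorem IsNav.navRel_smul (hb : IsNav b w) {t : ℝ} (ht : 0 < t) (y : V) :
    navRel b w (t • y) = t • navRel b w y := by
  rw [navRel, navRel, hb.navNorm_smul ht, smul_sub, mul_smul]

end Pointwise

section Calculus

variable {P : Type*} [NormedAddCommGroup P] [NormedSpace ℝ P]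
  {b : P → V →L[ℝ] V →L[ℝ] ℝ} {w y : P → V} {p : P}
  {b' : P →L[ℝ] V →L[ℝ] V →L[ℝ] ℝ} {w' y' : P →L[ℝ] V}

theorem hasFDerivAt_bilin {v z : P → V} {v' z' : P →L[ℝ] V} (hb : HasFDerivAt b b' p)
    (hv : HasFDerivAt v v' p) (hz : HasFDerivAt z z' p) :
    ∃ f' : P →L[ℝ] ℝ, HasFDerivAt (fun q => b q (v q) (z q)) f' p ∧
      ∀ q, f' q = b' q (v p) (z p) + b p (v' q) (z p) + b p (v p) (z' q) := by
  refine ⟨_, (hb.clm_apply hv).clm_apply hz, fun q => ?_⟩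
  simp
  ring

theorem IsNav.differentiableAt_navNorm (h : IsNav (b p) (w p)) (hy0 : y p ≠ 0)
    (hb : HasFDerivAt b b' p) (hw : HasFDerivAt w w' p) (hy : HasFDerivAt y y' p) :
    DifferentiableAt ℝ (fun q => navNorm (b q) (w q) (y q)) p := by
  obtain ⟨_, h1, -⟩ := hasFDerivAt_bilin hb hw hw
  obtain ⟨_, h2, -⟩ := hasFDerivAt_bilin hb hw hy
  obtain ⟨_, h3, -⟩ := hasFDerivAt_bilin hb hy hy
  have h1 := h1.differentiableAt
  have h2 := h2.differentiableAt
  have h3 := h3.differentiableAt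
  have h4 : DifferentiableAt ℝ (fun q => navDisc (b q) (w q) (y q)) p :=
    DifferentiableAt.sqrt ((((differentiableAt_const 1).sub h1).mul h3).add (h2.pow 2))
      (h.radicand_pos hy0).ne'
  have h5 : DifferentiableAt ℝ (fun q => 1 - b q (w q) (w q)) p :=
    (differentiableAt_const 1).sub h1
  change DifferentiableAt ℝ (fun q => (navDisc (b q) (w q) (y q) - b q (w q) (y q))
    / (1 - b q (w q) (w q))) p
  simp only [div_eq_mul_inv]
  exact (h4.fun_sub h2).fun_mul
    ((hasDerivAt_inv h.lam_pos.ne').comp_hasFDerivAt p h5.hasFDerivAt).differentiableAt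

/-- Derivative of the Randers norm, obtained by differentiating the implicit equation
`b u u = F ^ 2`, where `u = y - F w`. -/
theorem IsNav.hasFDerivAt_navNorm (h : ∀ᶠ q in nhds p, IsNav (b q) (w q)) (hy0 : y p ≠ 0)
    (hb : HasFDerivAt b b' p) (hw : HasFDerivAt w w' p) (hy : HasFDerivAt y y' p) :
    ∃ f' : P →L[ℝ] ℝ, HasFDerivAt (fun q => navNorm (b q) (w q) (y q)) f' p ∧
      ∀ q, f' q * navDisc (b p) (w p) (y p) =
        b p (navRel (b p) (w p) (y p)) (y' q - navNorm (b p) (w p) (y p) • w' q)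
          + 1 / 2 * b' q (navRel (b p) (w p) (y p)) (navRel (b p) (w p) (y p)) := by
  have hp := h.self_of_nhds
  have hF := (hp.differentiableAt_navNorm hy0 hb hw hy).hasFDerivAt
  refine ⟨_, hF, fun q => ?_⟩
  have hu : HasFDerivAt (fun q => navRel (b q) (w q) (y q)) _ p := hy.sub (hF.smul hw)
  obtain ⟨g', hg, hg'⟩ := hasFDerivAt_bilin hb hu hu
  have hg2 : HasFDerivAt (fun q => navNorm (b q) (w q) (y q) ^ 2) g' p := by
    refine hg.congr_of_eventuallyEq ?_
    filter_upwards [h] with q hq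
    exact (hq.navRel_sq (y q)).symm
  have h5 := hg2.unique (hF.pow 2)
  have h6 := congrArg (fun f : P →L[ℝ] ℝ => f q) h5
  simp only [hg'] at h6
  rw [hp.navDisc_eq]
  set F := navNorm (b p) (w p) (y p) with hFdef
  set u := navRel (b p) (w p) (y p) with hudef
  set F' := fderiv ℝ (fun q => navNorm (b q) (w q) (y q)) p
  simp only [sub_apply, smul_apply,
    add_apply, ContinuousLinearMap.smulRight_apply, map_sub, map_add, map_smul,
    smul_eq_mul, hp.symm _ u, nsmul_eq_mul] at h6 ⊢
  norm_num at h6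
  linear_combination (-1 / 2) * h6

/-- The derivatives of the Randers norm, of `u = y - F w` and of the discriminant, as the metric,
the wind and the vector all depend on a parameter. -/
theorem IsNav.hasFDerivAt_all (h : ∀ᶠ q in nhds p, IsNav (b q) (w q)) (hy0 : y p ≠ 0)
    (hb : HasFDerivAt b b' p) (hw : HasFDerivAt w w' p) (hy : HasFDerivAt y y' p) :
    ∃ (f' : P →L[ℝ] ℝ) (u' : P →L[ℝ] V) (d' : P →L[ℝ] ℝ),
      HasFDerivAt (fun q => navNorm (b q) (w q) (y q)) f' p ∧
      HasFDerivAt (fun q => navRel (b q) (w q) (y q)) u' p ∧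
      HasFDerivAt (fun q => navDisc (b q) (w q) (y q)) d' p ∧
      (∀ q, f' q * navDisc (b p) (w p) (y p) =
        b p (navRel (b p) (w p) (y p)) (y' q - navNorm (b p) (w p) (y p) • w' q)
          + 1 / 2 * b' q (navRel (b p) (w p) (y p)) (navRel (b p) (w p) (y p))) ∧
      (∀ q, u' q = y' q - f' q • w p - navNorm (b p) (w p) (y p) • w' q) ∧
      (∀ q, d' q = f' q + b' q (navRel (b p) (w p) (y p)) (w p) + b p (u' q) (w p)
        + b p (navRel (b p) (w p) (y p)) (w' q)) := by
  obtain ⟨f', hF, hf'⟩ := IsNav.hasFDerivAt_navNorm h hy0 hb hw hy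
  have hu : HasFDerivAt (fun q => navRel (b q) (w q) (y q)) _ p := hy.sub (hF.smul hw)
  obtain ⟨g', hg, hg'⟩ := hasFDerivAt_bilin hb hu hw
  refine ⟨f', _, f' + g', hF, hu, ?_, hf', fun q => ?_, fun q => ?_⟩
  · refine (hF.add hg).congr_of_eventuallyEq ?_
    filter_upwards [h] with q hq
    exact hq.navDisc_eq (y q)
  · simp; abel
  · rw [add_apply, hg']; ring

end Calculus

/-! ### The spray of a Randers metric -/

section Sharp

variable {b : V →L[ℝ] V →L[ℝ] ℝ} {w : V}

theorem IsNav.isInvertible [FiniteDimensional ℝ V] (hb : IsNav b w) : b.IsInvertible := by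
  have hinj : Function.Injective b := by
    rw [injective_iff_map_eq_zero]
    intro v hv
    by_contra h
    have := hb.pos v h
    simp [hv] at this
  have hdim : Module.finrank ℝ V = Module.finrank ℝ (V →L[ℝ] ℝ) := by
    rw [← (LinearMap.toContinuousLinearMap (𝕜 := ℝ) (E := V) (F' := ℝ)).finrank_eq]
    exact (Subspace.dual_finrank_eq).symm
  have : FiniteDimensional ℝ (V →L[ℝ] ℝ) :=
    (LinearMap.toContinuousLinearMap (𝕜 := ℝ) (E := V) (F' := ℝ)).finiteDimensional
  exact ⟨(LinearEquiv.ofInjectiveOfFinrankEq (b : V →ₗ[ℝ] V →L[ℝ] ℝ) hinj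
    hdim).toContinuousLinearEquiv, by ext; rfl⟩

/-- `b.inverse φ` is the vector dual to the covector `φ`. -/
theorem IsNav.apply_inverse [FiniteDimensional ℝ V] (hb : IsNav b w) (φ : V →L[ℝ] ℝ) (z : V) :
    b (b.inverse φ) z = φ z := by
  rw [hb.isInvertible.self_apply_inverse]

theorem IsNav.apply_inverse' [FiniteDimensional ℝ V] (hb : IsNav b w) (φ : V →L[ℝ] ℝ) (z : V) :
    b z (b.inverse φ) = φ z := by
  rw [hb.symm, hb.apply_inverse]

end Sharp

section Spray

variable (b : V →L[ℝ] V →L[ℝ] ℝ) (b' : V →L[ℝ] V →L[ℝ] V →L[ℝ] ℝ) (w : V) (a : V →L[ℝ] V)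

/-- The Lie derivative of the metric `b` along the vector field `w` at a point where `b` has
derivative `b'` and `w` has derivative `a`. -/
def navLie (v z : V) : ℝ := b' w v z + b (a v) z + b v (a z)

/-- The scalar `c(y) = (L_w b)(u, u) / (2 F(y))`, where `u = y - F(y) w`; up to a constant factor
it is the S-curvature. -/
def navCoeff (y : V) : ℝ :=
  navLie b b' w a (navRel b w y) (navRel b w y) / (2 * navNorm b w y)

/-- The covector `z ↦ -F b(u, ∂_z w) + ½ (∂_z b)(u, u) - (∂_y b)(u, z)`, the part of the geodesic
equation which has to be converted into a vector by `b`. The scalar `F` and the vectors `y`, `u`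
are free here, so that it is linear in each of `F` and `y`. -/
def navForce (F : ℝ) (y u : V) : V →L[ℝ] ℝ :=
  -(F • (b u).comp a) + (1 / 2 : ℝ) • (b'.flip u).flip u - b' y u

/-- The spray `G(y)` of the Randers metric, in terms of the first derivatives `b'` of the metric
and `a` of the wind. -/
def navSpray (y : V) : V :=
  -(1 / 2 : ℝ) • (navNorm b w y • a y + navCoeff b b' w a y • navRel b w y
    + b.inverse (navForce b b' a (navNorm b w y) y (navRel b w y)))

variable {b b' w a}

theorem navForce_apply (F : ℝ) (y u z : V) :
    navForce b b' a F y u z = -(F * b u (a z)) + 1 / 2 * b' z u u - b' y u z := by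
  simp [navForce]

/-- The momentum covector `F F_y`, evaluated at `z`. -/
def navMom (b : V →L[ℝ] V →L[ℝ] ℝ) (w y z : V) : ℝ :=
  navNorm b w y * b (navRel b w y) z / navDisc b w y

end Spray

section Joint

variable {b : V → V →L[ℝ] V →L[ℝ] ℝ} {b' : V →L[ℝ] V →L[ℝ] V →L[ℝ] ℝ} {w : V → V} {a : V →L[ℝ] V}
  {x : V}

/-- The first-order data at `x` of a metric `b` and a vector field `w`: `b'` and `a` are their
derivatives. -/
structure NavAt (b : V → V →L[ℝ] V →L[ℝ] ℝ) (b' : V →L[ℝ] V →L[ℝ] V →L[ℝ] ℝ) (w : V → V)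
    (a : V →L[ℝ] V) (x : V) : Prop where
  nav : ∀ᶠ z in nhds x, IsNav (b z) (w z)
  deriv_metric : HasFDerivAt b b' x
  deriv_field : HasFDerivAt w a x

theorem NavAt.symm' (h : NavAt b b' w a x) (q v z : V) : b' q v z = b' q z v := by
  have h1 : HasFDerivAt (fun x => b x v z) _ x :=
    (h.deriv_metric.clm_apply (hasFDerivAt_const v x)).clm_apply (hasFDerivAt_const z x)
  have h2 : HasFDerivAt (fun x => b x z v) _ x :=
    (h.deriv_metric.clm_apply (hasFDerivAt_const z x)).clm_apply (hasFDerivAt_const v x)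
  have h3 := h1.unique (h2.congr_of_eventuallyEq (h.nav.mono fun q hq => hq.symm v z))
  simpa using congrArg (fun f : V →L[ℝ] ℝ => f q) h3

theorem NavAt.self (h : NavAt b b' w a x) : IsNav (b x) (w x) := h.nav.self_of_nhds

/-- The derivatives `f'`, `u'` and `m'` of the Randers norm, of `u = y - F w` and of the momentum as
functions of `(x, y)`. The formula for `m'` is written with the derivative `d'` of the
discriminant. -/
theorem NavAt.exists_deriv (h : NavAt b b' w a x) {y : V} (hy : y ≠ 0) :
    ∃ (f' : V × V →L[ℝ] ℝ) (u' : V × V →L[ℝ] V) (d' : V × V →L[ℝ] ℝ)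
      (m' : V → V × V →L[ℝ] ℝ),
      HasFDerivAt (fun q : V × V => navNorm (b q.1) (w q.1) q.2) f' (x, y) ∧
      HasFDerivAt (fun q : V × V => navRel (b q.1) (w q.1) q.2) u' (x, y) ∧
      (∀ z, HasFDerivAt (fun q : V × V => navMom (b q.1) (w q.1) q.2 z) (m' z) (x, y)) ∧
      (∀ q v, f' (q, v) * navDisc (b x) (w x) y =
        b x (navRel (b x) (w x) y) (v - navNorm (b x) (w x) y • a q)
          + 1 / 2 * b' q (navRel (b x) (w x) y) (navRel (b x) (w x) y)) ∧
      (∀ q v, u' (q, v) = v - f' (q, v) • w x - navNorm (b x) (w x) y • a q) ∧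
      (∀ q v, d' (q, v) = f' (q, v) + b' q (navRel (b x) (w x) y) (w x) + b x (u' (q, v)) (w x)
        + b x (navRel (b x) (w x) y) (a q)) ∧
      (∀ z q v, m' z (q, v) * navDisc (b x) (w x) y ^ 2 =
        (f' (q, v) * b x (navRel (b x) (w x) y) z + navNorm (b x) (w x) y *
          (b' q (navRel (b x) (w x) y) z + b x (u' (q, v)) z)) * navDisc (b x) (w x) y
        - navNorm (b x) (w x) y * b x (navRel (b x) (w x) y) z * d' (q, v)) := by
  have hnav : ∀ᶠ q : V × V in nhds (x, y), IsNav (b q.1) (w q.1) :=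
    (continuous_fst.tendsto (x, y)).eventually h.nav
  have hfst : HasFDerivAt (Prod.fst : V × V → V) (ContinuousLinearMap.fst ℝ V V) (x, y) :=
    hasFDerivAt_fst
  have hdb : HasFDerivAt b b' (Prod.fst (x, y)) := h.deriv_metric
  have hdw : HasFDerivAt w a (Prod.fst (x, y)) := h.deriv_field
  have hb : HasFDerivAt (fun q : V × V => b q.1) _ (x, y) := hdb.comp (x, y) hfst
  have hw : HasFDerivAt (fun q : V × V => w q.1) _ (x, y) := hdw.comp (x, y) hfst
  have hy' : HasFDerivAt (fun q : V × V => q.2) (ContinuousLinearMap.snd ℝ V V) (x, y) :=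
    hasFDerivAt_snd
  obtain ⟨f', u', d', hf, hu, hd, hf', hu', hd'⟩ := IsNav.hasFDerivAt_all hnav hy hb hw hy'
  have hm : ∀ z, ∃ m' : V × V →L[ℝ] ℝ,
      HasFDerivAt (fun q : V × V => navMom (b q.1) (w q.1) q.2 z) m' (x, y) ∧
      ∀ q v, m' (q, v) * navDisc (b x) (w x) y ^ 2 =
        (f' (q, v) * b x (navRel (b x) (w x) y) z + navNorm (b x) (w x) y *
          (b' q (navRel (b x) (w x) y) z + b x (u' (q, v)) z)) * navDisc (b x) (w x) y
        - navNorm (b x) (w x) y * b x (navRel (b x) (w x) y) z * d' (q, v) := by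
    intro z
    obtain ⟨g', hg, hg'⟩ := hasFDerivAt_bilin hb hu (hasFDerivAt_const z (x, y))
    have hD := (h.self.navDisc_pos hy).ne'
    have hi := (hasDerivAt_inv hD).comp_hasFDerivAt (x, y) hd
    refine ⟨_, (hf.fun_mul hg).fun_mul hi, fun q v => ?_⟩
    simp [hg']
    field_simp
    ring
  choose m' hm hm' using hm
  refine ⟨f', u', d', m', hf, hu, hm, ?_, ?_, ?_, hm'⟩
  · intro q v; simpa using hf' (q, v)
  · intro q v; simpa using hu' (q, v)
  · intro q v; simpa using hd' (q, v)

/-- The Euler–Lagrange equation: along the geodesic vector field `(y, -2G)` the momentum `F F_y`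
changes at the rate `F F_x`. -/
theorem NavAt.momentum_spray [FiniteDimensional ℝ V] (h : NavAt b b' w a x) {y : V} (hy : y ≠ 0)
    (z : V) :
    fderiv ℝ (fun q : V × V => navMom (b q.1) (w q.1) q.2 z) (x, y)
        (y, -(2 : ℝ) • navSpray (b x) b' (w x) a y)
      = navNorm (b x) (w x) y
        * fderiv ℝ (fun q : V × V => navNorm (b q.1) (w q.1) q.2) (x, y) (z, 0) := by
  obtain ⟨f', u', d', m', hf, hu, hm, hf', hu', hd', hm'⟩ := h.exists_deriv hy
  rw [(hm z).fderiv, hf.fderiv]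
  have hb := h.self
  have hD := hb.navDisc_pos hy
  have hF := hb.navNorm_pos hy
  have hDF := hb.navDisc_eq y
  have hsq := hb.navRel_sq y
  have hyu : y = navRel (b x) (w x) y + navNorm (b x) (w x) y • w x := by simp [navRel]
  have hG : -(2 : ℝ) • navSpray (b x) b' (w x) a y
      = navNorm (b x) (w x) y • a y + navCoeff (b x) b' (w x) a y • navRel (b x) (w x) y
    + (b x).inverse (navForce (b x) b' a (navNorm (b x) (w x) y) y (navRel (b x) (w x) y)) := by
    rw [navSpray, smul_smul]; norm_num
  set G := -(2 : ℝ) • navSpray (b x) b' (w x) a y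
  have hc : navCoeff (b x) b' (w x) a y * (2 * navNorm (b x) (w x) y)
      = navLie (b x) b' (w x) a (navRel (b x) (w x) y) (navRel (b x) (w x) y) :=
    div_mul_cancel₀ _ (by positivity)
  have hr := hb.apply_inverse
    (navForce (b x) b' a (navNorm (b x) (w x) y) y (navRel (b x) (w x) y))
  have hr' := hb.apply_inverse'
    (navForce (b x) b' a (navNorm (b x) (w x) y) y (navRel (b x) (w x) y))
  set r := (b x).inverse (navForce (b x) b' a (navNorm (b x) (w x) y) y (navRel (b x) (w x) y))
  simp only [navForce_apply] at hr hr'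
  set c := navCoeff (b x) b' (w x) a y
  set F := navNorm (b x) (w x) y
  set D := navDisc (b x) (w x) y
  set u := navRel (b x) (w x) y
  simp only [navLie] at hc
  have hay : a y = a u + F • a (w x) := by
    conv_lhs => rw [hyu, map_add, map_smul]
  have hby : b' y = b' u + F • b' (w x) := by
    conv_lhs => rw [hyu, map_add, map_smul]
  have hsu := h.symm' u (w x) u
  have hsw := h.symm' (w x) (w x) u
  -- `F` is constant along geodesics; below, `G` abbreviates `-2` times the spray.
  have hf0 : f' (y, G) = 0 := by
    have h1 := hf' y G
    have : f' (y, G) * D = 0 := by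
      rw [h1, hG]
      simp only [map_add, map_sub, map_smul, smul_eq_mul, hr', hay, hby, add_apply, smul_apply,
        hsq] at hc ⊢
      rw [hb.symm (a u) u] at hc
      linear_combination F / 2 * hc
    exact (mul_eq_zero.1 this).resolve_right hD.ne'
  have hu0 : u' (y, G) = c • u + r := by
    rw [hu', hf0, hG]; module
  have hd0 : d' (y, G) = c * D := by
    rw [hd', hf0, hu0, hDF]
    simp only [map_add, map_smul, smul_eq_mul, hr, hay, hby, add_apply, smul_apply] at hc ⊢
    rw [hb.symm (a u) u] at hc
    linear_combination (-1 / 2) * hc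
  have h2 := hm' z y G
  have h3 := hf' z 0
  rw [hf0, hd0, hu0] at h2
  simp only [map_add, map_smul, zero_sub, map_neg, smul_eq_mul, hr, add_apply, smul_apply] at h2 h3
  apply mul_right_cancel₀ (pow_pos hD 2).ne'
  linear_combination h2 - F * D * h3

/-- The fibre derivative of the momentum, that is, the fundamental form, is nondegenerate. -/
theorem NavAt.momentum_nondegenerate (h : NavAt b b' w a x) {y v : V} (hy : y ≠ 0)
    (hv : ∀ z, fderiv ℝ (fun q : V × V => navMom (b q.1) (w q.1) q.2 z) (x, y) (0, v) = 0) :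
    v = 0 := by
  obtain ⟨f', u', d', m', hf, hu, hm, hf', hu', hd', hm'⟩ := h.exists_deriv hy
  simp only [fun z => (hm z).fderiv] at hv
  have hb := h.self
  have hD := hb.navDisc_pos hy
  have hF := hb.navNorm_pos hy
  have hDF := hb.navDisc_eq y
  have hsq := hb.navRel_sq y
  set F := navNorm (b x) (w x) y
  set D := navDisc (b x) (w x) y
  set u := navRel (b x) (w x) y
  have h1 := hf' 0 v
  have h2 := hu' 0 v
  have h3 := hd' 0 v
  have h4 := fun z => hm' z 0 v
  set f := f' (0, v)
  set d := d' (0, v)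
  simp only [hv, map_zero, smul_zero, sub_zero, zero_apply, add_zero, mul_zero, zero_mul, zero_add]
    at h1 h2 h3 h4
  -- The derivative of the momentum is `b` applied to this vector, up to a nonzero factor.
  have h5 : (f * D - F * d) • u + (F * D) • (v - f • w x) = 0 := by
    by_contra hne
    have := hb.pos _ hne
    have h6 := h4 ((f * D - F * d) • u + (F * D) • (v - f • w x))
    rw [h2] at h6
    have h7 : ∀ q, b x ((f * D - F * d) • u + (F * D) • (v - f • w x)) q
        = (f * D - F * d) * b x u q + F * D * b x (v - f • w x) q := by
      intro q
      simp only [map_add, map_smul, add_apply, smul_apply, smul_eq_mul]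
    rw [h7] at this
    linarith
  -- Pairing `v` with `u` and with `w` gives two equations, which force `f = d = 0`.
  have h6 : (F * D) • v = (F * D * f) • w x - (f * D - F * d) • u := by
    rw [← sub_eq_zero, ← h5]; module
  have h7 : F * d = 2 * D * f := by
    have e1 := congrArg (b x u) h6
    simp only [map_sub, map_smul, smul_eq_mul, hsq] at e1
    rw [← h1] at e1
    have : F ^ 2 * (F * d - 2 * D * f) = 0 := by
      linear_combination -e1 + (F * D * f) * hDF
    linarith [(mul_eq_zero.1 this).resolve_left (by positivity)]
  have h8 : f = 0 := by
    have e1 := congrArg (fun v => b x v (w x)) h6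
    rw [h2] at h3
    simp only [map_sub, map_smul, smul_eq_mul, sub_apply, smul_apply] at e1 h3
    have : D * D * f = 0 := by
      linear_combination e1 + F * D * h3 - (D * f) * hDF - (D - b x u (w x)) * h7
    exact (mul_eq_zero.1 this).resolve_left (by positivity)
  have hd0 : d = 0 := by
    rw [h8, mul_zero] at h7
    exact (mul_eq_zero.1 h7).resolve_left hF.ne'
  rw [h8, hd0] at h6
  have : (F * D) • v = 0 := by rw [h6]; simp
  exact (smul_eq_zero.1 this).resolve_left (by positivity)

end Joint

end Norm

/-! ### Geodesic coefficients in coordinates -/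

section Coordinates

variable {n : ℕ} {F : E n → E n → ℝ} {b : E n → E n →L[ℝ] E n →L[ℝ] ℝ}
  {b' : E n →L[ℝ] E n →L[ℝ] E n →L[ℝ] ℝ} {w : E n → E n} {a : E n →L[ℝ] E n} {x : E n}

theorem sum_smul_single (y : E n) :
    ∑ k, y k • (EuclideanSpace.single k (1 : ℝ) : E n) = y := by
  ext j
  simp [Pi.single_apply]

theorem sum_mul_apply_single (φ : E n →L[ℝ] ℝ) (y : E n) :
    ∑ k, φ (EuclideanSpace.single k 1) * y k = φ y := by
  conv_rhs => rw [← sum_smul_single y, map_sum]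
  simp [mul_comm]

theorem pd_congr {φ ψ : E n → ℝ} (h : φ =ᶠ[nhds x] ψ) (i : Fin n) : pd i φ x = pd i ψ x := by
  rw [pd, pd, h.fderiv_eq]

/-- `F` is, near `x`, the Randers metric with navigation data `(b, w)`. -/
def IsRandersAt (F : E n → E n → ℝ) (b : E n → E n →L[ℝ] E n →L[ℝ] ℝ) (w : E n → E n)
    (x : E n) : Prop :=
  ∀ᶠ z in nhds x, ∀ y, F z y = navNorm (b z) (w z) y

theorem IsNav.hasFDerivAt_navNorm_fiber {V : Type*} [NormedAddCommGroup V] [NormedSpace ℝ V]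
    {b : V →L[ℝ] V →L[ℝ] ℝ} {w y : V} (hb : IsNav b w) (hy : y ≠ 0) :
    HasFDerivAt (navNorm b w) ((navDisc b w y)⁻¹ • b (navRel b w y)) y := by
  obtain ⟨f', hf, hf'⟩ := IsNav.hasFDerivAt_navNorm (b := fun _ => b) (w := fun _ => w)
    (Filter.Eventually.of_forall fun _ => hb) hy (hasFDerivAt_const b y) (hasFDerivAt_const w y)
    (hasFDerivAt_id y)
  have h1 : (navDisc b w y)⁻¹ • b (navRel b w y) = f' := by
    ext v
    have h2 : f' v * navDisc b w y = b (navRel b w y) v := by simpa using hf' v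
    have hD := (hb.navDisc_pos hy).ne'
    rw [smul_apply, smul_eq_mul, ← h2]
    field_simp
  rw [h1]
  exact hf

theorem IsNav.pd_sq {b : E n →L[ℝ] E n →L[ℝ] ℝ} {w y : E n} (hb : IsNav b w) (hy : y ≠ 0)
    (l : Fin n) :
    pd l (fun y' => navNorm b w y' ^ 2) y = 2 * navMom b w y (EuclideanSpace.single l 1) := by
  rw [pd, ((hb.hasFDerivAt_navNorm_fiber hy).pow 2).fderiv]
  simp [navMom]
  ring

theorem hasFDerivAt_left {V : Type*} [NormedAddCommGroup V] [NormedSpace ℝ V]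
    {g : V × V → ℝ} {x y : V} (hg : DifferentiableAt ℝ g (x, y)) :
    HasFDerivAt (fun x' => g (x', y)) ((fderiv ℝ g (x, y)).comp (.inl ℝ V V)) x :=
  HasFDerivAt.comp x (f := fun x' => (x', y)) hg.hasFDerivAt (hasFDerivAt_prodMk_left x y)

theorem hasFDerivAt_right {V : Type*} [NormedAddCommGroup V] [NormedSpace ℝ V]
    {g : V × V → ℝ} {x y : V} (hg : DifferentiableAt ℝ g (x, y)) :
    HasFDerivAt (fun y' => g (x, y')) ((fderiv ℝ g (x, y)).comp (.inr ℝ V V)) y :=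
  HasFDerivAt.comp y (f := fun y' => (x, y')) hg.hasFDerivAt (hasFDerivAt_prodMk_right x y)

theorem NavAt.differentiableAt_navMom (h : NavAt b b' w a x) {y : E n} (hy : y ≠ 0) (z : E n) :
    DifferentiableAt ℝ (fun q : E n × E n => navMom (b q.1) (w q.1) q.2 z) (x, y) := by
  obtain ⟨f', u', d', m', hf, hu, hm, -⟩ := h.exists_deriv hy
  exact (hm z).differentiableAt

theorem NavAt.differentiableAt_navNorm (h : NavAt b b' w a x) {y : E n} (hy : y ≠ 0) :
    DifferentiableAt ℝ (fun q : E n × E n => navNorm (b q.1) (w q.1) q.2) (x, y) := by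
  obtain ⟨f', u', d', m', hf, -⟩ := h.exists_deriv hy
  exact hf.differentiableAt

/-- The fundamental matrix is the fibre derivative of the momentum. -/
theorem NavAt.fundMatrix_eq (h : NavAt b b' w a x) (hF : IsRandersAt F b w x) {y : E n}
    (hy : y ≠ 0) (i j : Fin n) :
    fundMatrix F x y i j = fderiv ℝ (fun q : E n × E n =>
      navMom (b q.1) (w q.1) q.2 (EuclideanSpace.single i 1)) (x, y)
      (0, EuclideanSpace.single j 1) := by
  have h1 : (fun y' => pd i (fun y'' => F x y'' ^ 2) y') =ᶠ[nhds y]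
      fun y' => 2 * navMom (b x) (w x) y' (EuclideanSpace.single i 1) := by
    filter_upwards [isOpen_ne.mem_nhds hy] with y' hy'
    simp only [hF.self_of_nhds]
    exact h.self.pd_sq hy' i
  rw [fundMatrix, Matrix.of_apply, pd_congr h1, pd,
    ((hasFDerivAt_right (h.differentiableAt_navMom hy _)).const_mul 2).fderiv]
  simp

theorem NavAt.fundMatrix_mulVec (h : NavAt b b' w a x) (hF : IsRandersAt F b w x) {y : E n}
    (hy : y ≠ 0) (v : E n) (i : Fin n) :
    (fundMatrix F x y).mulVec v i = fderiv ℝ (fun q : E n × E n =>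
      navMom (b q.1) (w q.1) q.2 (EuclideanSpace.single i 1)) (x, y) (0, v) := by
  simp only [Matrix.mulVec, dotProduct, h.fundMatrix_eq hF hy]
  exact sum_mul_apply_single ((fderiv ℝ (fun q : E n × E n =>
      navMom (b q.1) (w q.1) q.2 (EuclideanSpace.single i 1)) (x, y)).comp (.inr ℝ _ _)) v

theorem NavAt.fderiv_navMom_apply (h : NavAt b b' w a x) {y : E n} (hy : y ≠ 0) (z : E n)
    (p : E n × E n) :
    fderiv ℝ (fun q : E n × E n => navMom (b q.1) (w q.1) q.2 z) (x, y) p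
      = ∑ i, fderiv ℝ (fun q : E n × E n =>
        navMom (b q.1) (w q.1) q.2 (EuclideanSpace.single i 1)) (x, y) p * z i := by
  have h1 : (fun q : E n × E n => navMom (b q.1) (w q.1) q.2 z) = fun q =>
      ∑ i, navMom (b q.1) (w q.1) q.2 (EuclideanSpace.single i 1) * z i := by
    funext q
    have := sum_mul_apply_single ((navNorm (b q.1) (w q.1) q.2 / navDisc (b q.1) (w q.1) q.2) •
      b q.1 (navRel (b q.1) (w q.1) q.2)) z
    simp only [smul_apply, smul_eq_mul] at this
    simp only [navMom]
    rw [mul_div_right_comm, ← this]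
    refine Finset.sum_congr rfl fun i _ => ?_
    ring
  rw [h1, fderiv_fun_sum]
  · simp only [sum_apply]
    refine Finset.sum_congr rfl fun i _ => ?_
    rw [fderiv_mul_const (h.differentiableAt_navMom hy _)]
    simp [mul_comm]
  · intro i _
    exact (h.differentiableAt_navMom hy _).mul_const _

theorem NavAt.isUnit_fundMatrix (h : NavAt b b' w a x) (hF : IsRandersAt F b w x) {y : E n}
    (hy : y ≠ 0) : IsUnit (fundMatrix F x y) := by
  rw [← Matrix.mulVec_injective_iff_isUnit]
  apply (injective_iff_map_eq_zero (Matrix.mulVecLin (fundMatrix F x y))).2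
  intro v hv
  have := h.momentum_nondegenerate hy (v := WithLp.toLp 2 v) (fun z => ?_)
  · simpa using this
  · rw [h.fderiv_navMom_apply hy]
    refine Finset.sum_eq_zero fun i _ => ?_
    rw [← h.fundMatrix_mulVec hF hy]
    have := congrFun hv i
    simp only [Matrix.mulVecLin_apply, Pi.zero_apply] at this
    simp [this]

theorem NavAt.geodesicCoeff_eq (h : NavAt b b' w a x) (hF : IsRandersAt F b w x) {y : E n}
    (hy : y ≠ 0) (i : Fin n) : geodesicCoeff F x y i = navSpray (b x) b' (w x) a y i := by
  set G := navSpray (b x) b' (w x) a y with hG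
  -- The bracket in the geodesic coefficients is `4 g G`, by the Euler–Lagrange equation.
  have key : ∀ l, (∑ k, pd k (fun x' => pd l (fun y' => F x' y' ^ 2) y) x * y k)
      - pd l (fun x' => F x' y ^ 2) x = 4 * (fundMatrix F x y).mulVec G l := by
    intro l
    have h1 : (fun x' => pd l (fun y' => F x' y' ^ 2) y) =ᶠ[nhds x]
        fun x' => 2 * navMom (b x') (w x') y (EuclideanSpace.single l 1) := by
      filter_upwards [hF, h.nav] with x' hx' hn
      simp only [hx']
      exact hn.pd_sq hy l
    have h2 : (fun x' => F x' y ^ 2) =ᶠ[nhds x] fun x' => navNorm (b x') (w x') y ^ 2 := by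
      filter_upwards [hF] with x' hx'
      rw [hx']
    rw [pd_congr h2, Finset.sum_congr rfl fun k _ => by rw [pd_congr h1], h.fundMatrix_mulVec hF hy]
    have h3 := hasFDerivAt_left (h.differentiableAt_navMom hy (EuclideanSpace.single l 1))
    have h4 := hasFDerivAt_left (h.differentiableAt_navNorm hy)
    simp only [pd]
    rw [(h3.const_mul 2).fderiv, (h4.pow 2).fderiv, sum_mul_apply_single]
    have h5 := h.momentum_spray hy (EuclideanSpace.single l 1)
    have h6 : (y, -(2 : ℝ) • navSpray (b x) b' (w x) a y) = (y, 0) - (2 : ℝ) • ((0 : E n), G) := by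
      simp [hG]
    rw [h6, map_sub, map_smul, smul_eq_mul] at h5
    simp
    linear_combination 2 * h5
  rw [geodesicCoeff]
  simp only [key]
  have hdet : IsUnit (fundMatrix F x y).det :=
    (Matrix.isUnit_iff_isUnit_det _).1 (h.isUnit_fundMatrix hF hy)
  have h7 : (fundMatrix F x y)⁻¹.mulVec ((fundMatrix F x y).mulVec G) i = G i := by
    rw [Matrix.mulVec_mulVec, Matrix.nonsing_inv_mul _ hdet, Matrix.one_mulVec]
  rw [← h7]
  change _ = ∑ l, (fundMatrix F x y)⁻¹ i l * (fundMatrix F x y).mulVec G l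
  rw [Finset.mul_sum]
  exact Finset.sum_congr rfl fun l _ => by ring

end Coordinates

/-! ### Fibre derivatives of the spray -/

section Fiber

variable {V : Type*} [NormedAddCommGroup V] [NormedSpace ℝ V] {b : V →L[ℝ] V →L[ℝ] ℝ}
  {b' : V →L[ℝ] V →L[ℝ] V →L[ℝ] ℝ} {w y : V} {a : V →L[ℝ] V}

/-- Pairing the spray with a fixed vector removes the inverse of `b`. -/
theorem IsNav.navSpray_pair [FiniteDimensional ℝ V] (hb : IsNav b w) (y z : V) :
    b (navSpray b b' w a y) z = -(1 / 2) * (navNorm b w y * b (a y) z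
      + navCoeff b b' w a y * b (navRel b w y) z
      + (-(navNorm b w y * b (navRel b w y) (a z)) + 1 / 2 * b' z (navRel b w y) (navRel b w y)
        - b' y (navRel b w y) z)) := by
  rw [← navForce_apply, ← hb.apply_inverse (navForce b b' a (navNorm b w y) y (navRel b w y)),
    navSpray]
  simp only [map_smul, map_add, smul_apply, add_apply, smul_eq_mul]

theorem IsNav.contDiffAt_navNorm (hb : IsNav b w) (hy : y ≠ 0) {k : WithTop ℕ∞} :
    ContDiffAt ℝ k (navNorm b w) y := by
  have h1 : ContDiffAt ℝ k (fun y => navDisc b w y) y :=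
    ContDiffAt.sqrt (by fun_prop) (hb.radicand_pos hy).ne'
  have h2 : ContDiffAt ℝ k (fun y => (navDisc b w y - b w y) / (1 - b w w)) y :=
    (h1.sub (by fun_prop)).div_const _
  exact h2

theorem IsNav.contDiffAt_navRel (hb : IsNav b w) (hy : y ≠ 0) {k : WithTop ℕ∞} :
    ContDiffAt ℝ k (navRel b w) y :=
  contDiffAt_id.sub ((hb.contDiffAt_navNorm hy).smul contDiffAt_const)

theorem IsNav.contDiffAt_navCoeff (hb : IsNav b w) (hy : y ≠ 0) {k : WithTop ℕ∞} :
    ContDiffAt ℝ k (navCoeff b b' w a) y := by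
  have hF := hb.contDiffAt_navNorm hy (k := k)
  have hu := hb.contDiffAt_navRel hy (k := k)
  have h2 : ContDiffAt ℝ k (fun y => navLie b b' w a (navRel b w y) (navRel b w y)) y := by
    unfold navLie; fun_prop
  exact h2.div (contDiffAt_const.mul hF) (mul_pos two_pos (hb.navNorm_pos hy)).ne'

theorem IsNav.contDiffAt_navSpray_pair [FiniteDimensional ℝ V] (hb : IsNav b w) (hy : y ≠ 0)
    (z : V) {k : WithTop ℕ∞} : ContDiffAt ℝ k (fun y => b (navSpray b b' w a y) z) y := by
  have hF := hb.contDiffAt_navNorm hy (k := k)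
  have hu := hb.contDiffAt_navRel hy (k := k)
  have hc := hb.contDiffAt_navCoeff (b' := b') (a := a) hy (k := k)
  simp only [hb.navSpray_pair]
  fun_prop

/-- The fibre derivatives `f'` of the Randers norm, `c'` of `navCoeff` and `g` of the spray paired
with a fixed vector. The fibre derivative of `u = y - F w` is `v ↦ v - f' v • w`. -/
theorem IsNav.exists_fiber_deriv [FiniteDimensional ℝ V] (hb : IsNav b w) (hy : y ≠ 0) :
    ∃ (f' : V →L[ℝ] ℝ) (c' : V →L[ℝ] ℝ),
      f' = (navDisc b w y)⁻¹ • b (navRel b w y) ∧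
      (∀ v, c' v = (navLie b b' w a (v - f' v • w) (navRel b w y)
        + navLie b b' w a (navRel b w y) (v - f' v • w)) / (2 * navNorm b w y)
        - navCoeff b b' w a y * f' v / navNorm b w y) ∧
      ∀ z, ∃ g : V →L[ℝ] ℝ, HasFDerivAt (fun y => b (navSpray b b' w a y) z) g y ∧
        ∀ v, g v = -(1 / 2) * (f' v * b (a y) z + navNorm b w y * b (a v) z
          + c' v * b (navRel b w y) z + navCoeff b b' w a y * b (v - f' v • w) z
          + (-(f' v * b (navRel b w y) (a z) + navNorm b w y * b (v - f' v • w) (a z))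
            + 1 / 2 * (b' z (v - f' v • w) (navRel b w y) + b' z (navRel b w y) (v - f' v • w))
            - b' v (navRel b w y) z - b' y (v - f' v • w) z)) := by
  have hF := hb.hasFDerivAt_navNorm_fiber hy
  set f' := (navDisc b w y)⁻¹ • b (navRel b w y)
  have hu : HasFDerivAt (navRel b w) (.id ℝ V - f'.smulRight w) y :=
    (hasFDerivAt_id y).sub (hF.smul_const w)
  have hF0 := (hb.navNorm_pos hy).ne'
  have hconst : ∀ v : V, HasFDerivAt (fun _ : V => v) (0 : V →L[ℝ] V) y :=
    fun v => hasFDerivAt_const v y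
  have hbc : HasFDerivAt (𝕜 := ℝ) (fun _ : V => b) 0 y := hasFDerivAt_const b y
  obtain ⟨l1, h1, h1'⟩ := hasFDerivAt_bilin (hasFDerivAt_const (𝕜 := ℝ) (b' w) y) hu hu
  obtain ⟨l2, h2, h2'⟩ := hasFDerivAt_bilin hbc (a.hasFDerivAt.comp y hu) hu
  obtain ⟨l3, h3, h3'⟩ := hasFDerivAt_bilin hbc hu (a.hasFDerivAt.comp y hu)
  obtain ⟨c', hc, hc'⟩ : ∃ c' : V →L[ℝ] ℝ, HasFDerivAt (navCoeff b b' w a) c' y ∧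
      ∀ v, c' v = (navLie b b' w a (v - f' v • w) (navRel b w y)
        + navLie b b' w a (navRel b w y) (v - f' v • w)) / (2 * navNorm b w y)
        - navCoeff b b' w a y * f' v / navNorm b w y := by
    refine ⟨_, ((h1.fun_add h2).fun_add h3).fun_mul
      ((hasDerivAt_inv (mul_ne_zero two_ne_zero hF0)).comp_hasFDerivAt y (hF.const_mul 2)),
      fun v => ?_⟩
    simp only [add_apply, smul_apply, smul_eq_mul, h1', h2', h3', zero_apply,
      ContinuousLinearMap.comp_apply, sub_apply, ContinuousLinearMap.smulRight_apply,
      ContinuousLinearMap.id_apply, navCoeff, navLie, Function.comp_apply]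
    field_simp
    ring
  refine ⟨f', c', rfl, hc', fun z => ?_⟩
  obtain ⟨m1, k1, k1'⟩ := hasFDerivAt_bilin hbc (a.hasFDerivAt (x := y)) (hconst z)
  obtain ⟨m2, k2, k2'⟩ := hasFDerivAt_bilin hbc hu (hconst z)
  obtain ⟨m3, k3, k3'⟩ := hasFDerivAt_bilin hbc hu (hconst (a z))
  obtain ⟨m4, k4, k4'⟩ := hasFDerivAt_bilin (hasFDerivAt_const (𝕜 := ℝ) (b' z) y) hu hu
  obtain ⟨m5, k5, k5'⟩ := hasFDerivAt_bilin (b'.hasFDerivAt (x := y)) hu (hconst z)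
  simp only [hb.navSpray_pair]
  refine ⟨_, ((((hF.fun_mul k1).fun_add (hc.fun_mul k2)).fun_add
    (((hF.fun_mul k3).fun_neg.fun_add (k4.const_mul (1 / 2))).fun_sub k5)).const_mul
      (-(1 / 2))), fun v => ?_⟩
  simp only [add_apply, sub_apply, smul_apply, neg_apply, smul_eq_mul, k1', k2', k3', k4', k5',
    zero_apply, map_zero, ContinuousLinearMap.smulRight_apply, ContinuousLinearMap.id_apply]
  ring

end Fiber

/-! ### Divergence of the spray -/

section Divergence

variable {n : ℕ} {b : E n →L[ℝ] E n →L[ℝ] ℝ} {b' : E n →L[ℝ] E n →L[ℝ] E n →L[ℝ] ℝ} {w y : E n}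
  {a : E n →L[ℝ] E n}

/-- The vector which is `b`-dual to the `i`-th coordinate function. -/
def coordDual (b : E n →L[ℝ] E n →L[ℝ] ℝ) (i : Fin n) : E n :=
  b.inverse (EuclideanSpace.proj i)

theorem IsNav.apply_coordDual (hb : IsNav b w) (v : E n) (i : Fin n) :
    b v (coordDual b i) = v i :=
  hb.apply_inverse' _ _

theorem IsNav.coordDual_symm (hb : IsNav b w) (i j : Fin n) :
    coordDual b i j = coordDual b j i := by
  rw [← hb.apply_coordDual, ← hb.apply_coordDual, hb.symm]

/-- The trace of a rank-one bilinear form `φ ⊗ ψ` with respect to `b`. -/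
theorem sum_mul_apply_coordDual (φ ψ : E n →L[ℝ] ℝ) :
    ∑ i, φ (EuclideanSpace.single i 1) * ψ (coordDual b i) = ψ (b.inverse φ) := by
  have h : φ = ∑ i, φ (EuclideanSpace.single i 1) • (EuclideanSpace.proj i : E n →L[ℝ] ℝ) := by
    ext v
    rw [← sum_mul_apply_single φ v]
    simp
  conv_rhs => rw [h, map_sum, map_sum]
  simp [coordDual]

/-- The trace of a bilinear form with respect to `b` agrees with that of its transpose. -/
theorem IsNav.sum_coordDual_flip (hb : IsNav b w) (T : E n →L[ℝ] E n →L[ℝ] ℝ) :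
    ∑ i, T (EuclideanSpace.single i 1) (coordDual b i)
      = ∑ i, T (coordDual b i) (EuclideanSpace.single i 1) := by
  have h1 : ∀ i, T (EuclideanSpace.single i 1) (coordDual b i) = ∑ j,
      T (EuclideanSpace.single i 1) (EuclideanSpace.single j 1) * coordDual b i j :=
    fun i => (sum_mul_apply_single _ _).symm
  have h2 : ∀ i, T (coordDual b i) (EuclideanSpace.single i 1) = ∑ j,
      T (EuclideanSpace.single j 1) (EuclideanSpace.single i 1) * coordDual b i j :=
    fun i => (sum_mul_apply_single (T.flip (EuclideanSpace.single i 1)) _).symm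
  simp only [h1, h2]
  rw [Finset.sum_comm]
  exact Finset.sum_congr rfl fun i _ => Finset.sum_congr rfl fun j _ => by
    rw [hb.coordDual_symm]

theorem IsNav.sum_apply_coordDual (hb : IsNav b w) :
    ∑ i, b (EuclideanSpace.single i 1) (coordDual b i) = n := by
  simp [hb.apply_coordDual]

/-- The fibre divergence of the spray. The first term on the right is the derivative of
`log √det b` along `y`. -/
theorem IsNav.sum_pd_navSpray (hb : IsNav b w) (hy : y ≠ 0)
    (hsymm : ∀ q v z, b' q v z = b' q z v) :
    ∑ i, pd i (fun y' => navSpray b b' w a y' i) y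
      = 1 / 2 * ∑ i, b' y (EuclideanSpace.single i 1) (coordDual b i)
        - (n + 1) / 2 * navCoeff b b' w a y := by
  obtain ⟨f', c', hf', hc', hg⟩ := hb.exists_fiber_deriv (b' := b') (a := a) hy
  choose g hg hg' using hg
  have hD := hb.navDisc_pos hy
  have hF := hb.navNorm_pos hy
  have hDF := hb.navDisc_eq y
  have hsq := hb.navRel_sq y
  have hyu : y = navRel b w y + navNorm b w y • w := by simp [navRel]
  have hlie : navLie b b' w a (navRel b w y) (navRel b w y)
      = navCoeff b b' w a y * (2 * navNorm b w y) := (div_mul_cancel₀ _ (by positivity)).symm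
  have hpd : ∀ i, pd i (fun y' => navSpray b b' w a y' i) y
      = g (coordDual b i) (EuclideanSpace.single i 1) := by
    intro i
    rw [pd]
    have : (fun y' => navSpray b b' w a y' i)
        = fun y' => b (navSpray b b' w a y') (coordDual b i) := by
      funext y'
      rw [hb.apply_coordDual]
    rw [this, (hg _).fderiv]
  set u := navRel b w y
  set F := navNorm b w y
  set D := navDisc b w y
  set c := navCoeff b b' w a y
  have hinv : b.inverse f' = D⁻¹ • u := by
    rw [hf', map_smul, hb.isInvertible.inverse_apply_self]
  have hS := fun φ ψ : E n →L[ℝ] ℝ => sum_mul_apply_coordDual (b := b) φ ψ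
  -- Traces of the terms of rank one, which contain `f'` or `c'`, and of the remaining ones.
  have t1 := hS f' (b (a y))
  have t2 := hS c' (b u)
  have t3 := hS f' (b w)
  have t4 := hS f' ((b u).comp a)
  have t5 := hS f' ((b w).comp a)
  have t6 := hS f' ((b'.flip w).flip u)
  have t7 := hS f' (b' y w)
  have t8 := hb.sum_coordDual_flip (b.comp a)
  have t9 := hb.sum_coordDual_flip (b'.flip u)
  have t10 := hb.sum_apply_coordDual
  rw [hinv] at t1 t3 t4 t5 t6 t7
  rw [hb.apply_inverse'] at t2
  simp only [map_smul, smul_eq_mul, ContinuousLinearMap.comp_apply, ContinuousLinearMap.flip_apply]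
    at t1 t2 t3 t4 t5 t6 t7 t8 t9
  have t8' : ∑ i, b (a (EuclideanSpace.single i 1)) (coordDual b i)
      = ∑ i, b (EuclideanSpace.single i 1) (a (coordDual b i)) := by
    rw [t8]; exact Finset.sum_congr rfl fun i _ => hb.symm _ _
  have hexp : ∀ i, g (coordDual b i) (EuclideanSpace.single i 1) = -(1 / 2) *
      (f' (EuclideanSpace.single i 1) * b (a y) (coordDual b i)
      + F * b (a (EuclideanSpace.single i 1)) (coordDual b i)
      + c' (EuclideanSpace.single i 1) * b u (coordDual b i)
      + c * b (EuclideanSpace.single i 1) (coordDual b i)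
      - c * (f' (EuclideanSpace.single i 1) * b w (coordDual b i))
      - f' (EuclideanSpace.single i 1) * b u (a (coordDual b i))
      - F * b (EuclideanSpace.single i 1) (a (coordDual b i))
      + F * (f' (EuclideanSpace.single i 1) * b w (a (coordDual b i)))
      + b' (coordDual b i) u (EuclideanSpace.single i 1)
      - f' (EuclideanSpace.single i 1) * b' (coordDual b i) w u
      - b' (EuclideanSpace.single i 1) u (coordDual b i)
      - b' y (EuclideanSpace.single i 1) (coordDual b i)
      + f' (EuclideanSpace.single i 1) * b' y w (coordDual b i)) := by
    intro i
    rw [hg']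
    simp only [map_sub, map_smul, sub_apply, smul_apply, smul_eq_mul,
      hsymm (coordDual b i) (EuclideanSpace.single i 1) u, hsymm (coordDual b i) u w]
    ring
  simp only [hpd, hexp, ← Finset.mul_sum, Finset.sum_add_distrib, Finset.sum_sub_distrib]
  rw [t1, t2, t3, t4, t5, t6, t7, t8', t9, t10, hc']
  have hfu : f' u = D⁻¹ * F ^ 2 := by
    rw [hf']; simp [hsq]
  rw [hfu]
  have hay : a y = a u + F • a w := by
    conv_lhs => rw [hyu, map_add, map_smul]
  have hby : b' y w u = b' u w u + F * b' w w u := by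
    conv_lhs => rw [hyu, map_add, map_smul]
    rfl
  simp only [navLie] at hlie ⊢
  simp only [map_sub, map_smul, sub_apply, smul_apply, smul_eq_mul]
  rw [hby, hay]
  simp only [map_smul, map_add, add_apply, smul_apply, smul_eq_mul]
  rw [hb.symm (a u) u] at hlie ⊢
  rw [hb.symm (a u) w, hb.symm (a w) u, hsymm w u w]
  have hcc : c = b' w u u / (2 * F) + b u (a u) / F := by
    field_simp
    linear_combination -hlie
  rw [hcc]
  rw [hDF] at hD ⊢
  rw [hb.symm w u]
  field_simp
  ring

end Divergence

/-! ### Homogeneity and the Berwald connection -/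

section Homogeneity

variable {V : Type*} [NormedAddCommGroup V] [NormedSpace ℝ V] {b : V →L[ℝ] V →L[ℝ] ℝ}
  {b' : V →L[ℝ] V →L[ℝ] V →L[ℝ] ℝ} {w y : V} {a : V →L[ℝ] V}

theorem IsNav.navCoeff_smul (hb : IsNav b w) {t : ℝ} (ht : 0 < t) (y : V) :
    navCoeff b b' w a (t • y) = t * navCoeff b b' w a y := by
  by_cases hF : navNorm b w y = 0
  · simp [navCoeff, hb.navNorm_smul ht, hF]
  · simp only [navCoeff, hb.navNorm_smul ht, hb.navRel_smul ht, navLie, map_smul, smul_apply,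
      smul_eq_mul]
    field_simp

theorem IsNav.navSpray_pair_smul [FiniteDimensional ℝ V] (hb : IsNav b w) {t : ℝ} (ht : 0 < t)
    (y z : V) :
    b (navSpray b b' w a (t • y)) z = t ^ 2 * b (navSpray b b' w a y) z := by
  rw [hb.navSpray_pair, hb.navSpray_pair, hb.navNorm_smul ht, hb.navRel_smul ht,
    hb.navCoeff_smul ht, ContinuousLinearMap.map_smul b' t y]
  simp only [map_smul, smul_apply, smul_eq_mul]
  ring

/-- Euler's identity for a function which is positively homogeneous of degree two. -/
theorem fderiv_apply_self_of_homogeneous {g : V → ℝ} (hg : DifferentiableAt ℝ g y)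
    (hom : ∀ t : ℝ, 0 < t → g (t • y) = t ^ 2 * g y) : fderiv ℝ g y y = 2 * g y := by
  have h1 : HasDerivAt (fun t : ℝ => t • y) y 1 := by
    simpa using (hasDerivAt_id (1 : ℝ)).smul_const y
  have h2 : HasDerivAt (fun t : ℝ => g (t • y)) (fderiv ℝ g y y) 1 := by
    have hg' : HasFDerivAt g (fderiv ℝ g y) ((1 : ℝ) • y) := by
      rw [one_smul]; exact hg.hasFDerivAt
    exact hg'.comp_hasDerivAt 1 h1
  have h3 : HasDerivAt (fun t : ℝ => t ^ 2 * g y) (2 * g y) 1 := by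
    simpa using (hasDerivAt_pow 2 (1 : ℝ)).mul_const (g y)
  refine h2.unique (h3.congr_of_eventuallyEq ?_)
  filter_upwards [lt_mem_nhds one_pos] with t ht using hom t ht

end Homogeneity

section Berwald

variable {n : ℕ} {F : E n → E n → ℝ} {b : E n → E n →L[ℝ] E n →L[ℝ] ℝ}
  {b' : E n →L[ℝ] E n →L[ℝ] E n →L[ℝ] ℝ} {w : E n → E n} {a : E n →L[ℝ] E n} {x : E n}

/-- For a function which is homogeneous of degree two near `y`, contracting the second derivative
with `y` gives back the first derivative. -/
theorem sum_pd_pd_of_homogeneous {g : E n → ℝ} {y : E n} (hg : ContDiffAt ℝ 2 g y)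
    (hom : ∀ᶠ z in nhds y, ∀ t : ℝ, 0 < t → g (t • z) = t ^ 2 * g z) (v : E n) :
    ∑ j, ∑ k, pd j (fun y' => pd k g y') y * v j * y k = fderiv ℝ g y v := by
  have hd : DifferentiableAt ℝ (fderiv ℝ g) y :=
    (hg.fderiv_right (m := 1) (by norm_num)).differentiableAt (by norm_num)
  have hev : ∀ᶠ z in nhds y, DifferentiableAt ℝ g z :=
    (hg.eventually (by simp)).mono fun z hz => hz.differentiableAt (by norm_num)
  have h1 : (fun z => fderiv ℝ g z z) =ᶠ[nhds y] fun z => 2 * g z := by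
    filter_upwards [hom, hev] with z hz hz'
    exact fderiv_apply_self_of_homogeneous hz' hz
  have h2 := (hd.hasFDerivAt.clm_apply (hasFDerivAt_id y)).unique
    ((hev.self_of_nhds.hasFDerivAt.const_mul 2).congr_of_eventuallyEq h1)
  have h3 := congrArg (fun f : E n →L[ℝ] ℝ => f v) h2
  simp at h3
  have h4 : ∀ j k, pd j (fun y' => pd k g y') y = fderiv ℝ (fderiv ℝ g) y
      (EuclideanSpace.single j 1) (EuclideanSpace.single k 1) := by
    intro j k
    have := hd.hasFDerivAt.clm_apply (hasFDerivAt_const (EuclideanSpace.single k (1 : ℝ)) y)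
    simp only [pd]
    rw [this.fderiv]
    simp
  have h5 : ∀ j, ∑ k, pd j (fun y' => pd k g y') y * v j * y k
      = (fderiv ℝ (fderiv ℝ g) y).flip y (EuclideanSpace.single j 1) * v j := by
    intro j
    rw [ContinuousLinearMap.flip_apply, ← sum_mul_apply_single _ y, Finset.sum_mul]
    refine Finset.sum_congr rfl fun k _ => ?_
    rw [h4]; ring
  simp only [h5]
  rw [sum_mul_apply_single, ContinuousLinearMap.flip_apply]
  linarith

/-- Since the spray is homogeneous of degree two, `Γⁱ_{jk}(y) vʲ yᵏ = ∂_v Gⁱ(y)`. Hence the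
covariant derivative of a field, with the field itself as reference vector, contains only first
derivatives of the spray. -/
theorem NavAt.covDeriv_apply (h : NavAt b b' w a x) (hF : IsRandersAt F b w x) {X : E n → E n}
    (hX : X x ≠ 0) (v : E n) (i : Fin n) :
    covDeriv F x (X x) v X i = (∑ j, v j * pd j (fun x' => X x' i) x)
      + fderiv ℝ (fun y => b x (navSpray (b x) b' (w x) a y) (coordDual (b x) i)) (X x) v := by
  have hb := h.self
  have h1 : ∀ j k, berwaldCoeff F x (X x) i j k = pd j (fun y' => pd k (fun y =>
      b x (navSpray (b x) b' (w x) a y) (coordDual (b x) i)) y') (X x) := by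
    intro j k
    rw [berwaldCoeff]
    apply pd_congr
    filter_upwards [isOpen_ne.mem_nhds hX] with y' hy'
    apply pd_congr
    filter_upwards [isOpen_ne.mem_nhds hy'] with y'' hy''
    rw [h.geodesicCoeff_eq hF hy'', hb.apply_coordDual]
  rw [← sum_pd_pd_of_homogeneous (hb.contDiffAt_navSpray_pair hX _)
    (Filter.Eventually.of_forall fun z t ht => hb.navSpray_pair_smul ht z _)]
  simp only [covDeriv, h1]

/-- `g_y(y, X) = F F_y(X)`, with the denominator cleared. -/
theorem NavAt.fundForm_self (h : NavAt b b' w a x) (hF : IsRandersAt F b w x) {y : E n}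
    (hy : y ≠ 0) (X : E n) :
    fundForm F x y y X * navDisc (b x) (w x) y
      = navNorm (b x) (w x) y * b x (navRel (b x) (w x) y) X := by
  have h1 : fundForm F x y y X = fderiv ℝ (fun q : E n × E n =>
      navMom (b q.1) (w q.1) q.2 y) (x, y) (0, X) := by
    rw [h.fderiv_navMom_apply hy, fundForm]
    refine Finset.sum_congr rfl fun i _ => ?_
    rw [← h.fundMatrix_mulVec hF hy, Matrix.mulVec, dotProduct, Finset.sum_mul]
    exact Finset.sum_congr rfl fun j _ => by ring
  obtain ⟨f', u', d', m', hf, hu, hm, hf', hu', hd', hm'⟩ := h.exists_deriv hy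
  rw [h1, (hm y).fderiv]
  have hb := h.self
  have hD := hb.navDisc_pos hy
  have hDF := hb.navDisc_eq y
  have hsq := hb.navRel_sq y
  have hyu : y = navRel (b x) (w x) y + navNorm (b x) (w x) y • w x := by simp [navRel]
  have e1 := hf' 0 X
  have e2 := hu' 0 X
  have e3 := hd' 0 X
  have e4 := hm' y 0 X
  set F₀ := navNorm (b x) (w x) y
  set D := navDisc (b x) (w x) y
  set u := navRel (b x) (w x) y
  set f := f' (0, X)
  set d := d' (0, X)
  have e5 : ∀ v, b x v y = b x v u + F₀ * b x v (w x) := by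
    intro v
    conv_lhs => rw [hyu]
    simp
  simp only [e5] at e4
  rw [e3, e2] at e4
  simp only [map_zero, smul_zero, sub_zero, zero_apply, add_zero, mul_zero, zero_add,
    map_sub, map_smul, sub_apply, smul_apply, smul_eq_mul] at e1 e4
  rw [hsq, hb.symm X u, hb.symm (w x) u, ← e1] at e4
  rw [← e1]
  apply mul_right_cancel₀ hD.ne'
  rw [hDF] at e4 ⊢
  linear_combination e4

end Berwald

/-! ### Reverse vectors and the reversible torsion -/

section Dual

variable {n : ℕ} {F : E n → E n → ℝ} {b : E n → E n →L[ℝ] E n →L[ℝ] ℝ}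
  {b' : E n →L[ℝ] E n →L[ℝ] E n →L[ℝ] ℝ} {w : E n → E n} {a : E n →L[ℝ] E n} {x : E n}

theorem innerSL_apply_eq_sum (ξ y : E n) : innerSL ℝ ξ y = ∑ i, ξ i * y i := by
  simp [PiLp.inner_apply, mul_comm]

theorem IsNav.inverse_innerSL_ne_zero {b : E n →L[ℝ] E n →L[ℝ] ℝ} {w : E n} (hb : IsNav b w)
    {ξ : E n} (hξ : ξ ≠ 0) : b.inverse (innerSL ℝ ξ) ≠ 0 := by
  intro h
  have h1 := hb.apply_inverse (innerSL ℝ ξ) ξ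
  rw [h] at h1
  simp at h1
  exact hξ (norm_eq_zero.1 (pow_eq_zero_iff two_ne_zero |>.1 h1.symm))

/-- The dual norm of the Randers norm is `ξ ↦ |ξ| + ξ(w)`, because the indicatrix is the unit
sphere of `b` translated by `w`. The supremum is attained at `w + v / |v|`, where `v` is the vector
`b`-dual to `ξ`. -/
theorem IsNav.dualMetric_eq {b : E n →L[ℝ] E n →L[ℝ] ℝ} {w : E n} (hb : IsNav b w)
    (hF : ∀ y, F x y = navNorm b w y) {ξ : E n} (hξ : ξ ≠ 0) :
    dualMetric F x ξ
      = √(innerSL ℝ ξ (b.inverse (innerSL ℝ ξ))) + innerSL ℝ ξ w := by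
  set v := b.inverse (innerSL ℝ ξ) with hv
  have hbv : ∀ z, b v z = innerSL ℝ ξ z := hb.apply_inverse _
  have hv0 : v ≠ 0 := hb.inverse_innerSL_ne_zero hξ
  have hpos := hb.pos v hv0
  rw [← hbv, ← hbv]
  have hr := Real.sqrt_pos.2 hpos
  have hrr := Real.sq_sqrt hpos.le
  set r := √(b v v)
  have hg : IsGreatest ((fun y : E n => ∑ i, ξ i * y i) '' {y | F x y = 1}) (r + b v w) := by
    constructor
    · refine ⟨w + r⁻¹ • v, ?_, ?_⟩
      · rw [Set.mem_ofPred_eq, hF, hb.navNorm_eq_one_iff]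
        simp only [add_sub_cancel_left, map_smul, smul_apply, smul_eq_mul]
        rw [← hrr]
        field_simp
      · change ∑ i, ξ i * (w + r⁻¹ • v) i = _
        rw [← innerSL_apply_eq_sum, ← hbv, map_add, map_smul, smul_eq_mul, ← hrr]
        field_simp
        ring
    · rintro _ ⟨y, hy, rfl⟩
      rw [Set.mem_ofPred_eq, hF, hb.navNorm_eq_one_iff] at hy
      change ∑ i, ξ i * y i ≤ _
      rw [← innerSL_apply_eq_sum, ← hbv]
      have h1 := hb.sq_le v (y - w)
      rw [hy, mul_one, ← hrr] at h1
      have h2 := abs_le_of_sq_le_sq h1 hr.le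
      rw [map_sub] at h2
      linarith [(abs_le.1 h2).2]
  exact hg.csSup_eq

theorem IsNav.legendreInv_apply {b : E n →L[ℝ] E n →L[ℝ] ℝ} {w : E n} (hb : IsNav b w)
    (hF : ∀ y, F x y = navNorm b w y) {ξ : E n} (hξ : ξ ≠ 0) :
    legendreInv F x ξ = dualMetric F x ξ •
      ((√(innerSL ℝ ξ (b.inverse (innerSL ℝ ξ))))⁻¹ • b.inverse (innerSL ℝ ξ) + w) := by
  have h1 : (fun ξ' => dualMetric F x ξ') =ᶠ[nhds ξ]
      fun ξ' => √(innerSL ℝ ξ' (b.inverse (innerSL ℝ ξ'))) + innerSL ℝ ξ' w := by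
    filter_upwards [isOpen_ne.mem_nhds hξ] with ξ' hξ'
    exact hb.dualMetric_eq hF hξ'
  set v := b.inverse (innerSL ℝ ξ) with hv
  have hbv : ∀ z, b v z = innerSL ℝ ξ z := hb.apply_inverse _
  have hpos := hb.pos v (hb.inverse_innerSL_ne_zero hξ)
  rw [hbv] at hpos
  have hs : HasFDerivAt (fun ξ' : E n => innerSL ℝ ξ') (innerSL ℝ) ξ :=
    (innerSL ℝ : E n →L[ℝ] E n →L[ℝ] ℝ).hasFDerivAt
  have h2 := (hs.clm_apply (b.inverse.hasFDerivAt.comp ξ hs)).sqrt hpos.ne'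
  have h3 := h2.fun_add (hs.clm_apply (hasFDerivAt_const w ξ))
  ext i
  change dualMetric F x ξ * pd i (fun ξ' => dualMetric F x ξ') ξ = _
  have h5 : fderiv ℝ (fun ξ' : E n => √(innerSL ℝ ξ' (b.inverse (innerSL ℝ ξ')))
      + innerSL ℝ ξ' w) ξ = _ := h3.fderiv
  rw [pd_congr h1, pd, h5]
  have h6 : ∀ z : E n, innerSL ℝ (EuclideanSpace.single i (1 : ℝ)) z = z i := fun z => by
    rw [innerSL_apply_eq_sum]; simp
  have h4 : innerSL ℝ ξ (b.inverse (innerSL ℝ (EuclideanSpace.single i (1 : ℝ)))) = v i := by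
    rw [← hbv, hb.apply_inverse', h6]
  simp only [add_apply, smul_apply, ContinuousLinearMap.comp_apply, h4, Function.comp_apply,
    ContinuousLinearMap.flip_apply, h6, ← hv, zero_apply, map_zero, zero_add, smul_eq_mul,
    PiLp.smul_apply, PiLp.add_apply]
  field_simp
  ring

/-- Reversal of unit vectors of `F` is the reflection of the translated unit sphere in its centre
`w`. -/
theorem IsNav.reverseVector_eq {b : E n →L[ℝ] E n →L[ℝ] ℝ} {w : E n} (hb : IsNav b w)
    (hF : ∀ y, F x y = navNorm b w y) {η : E n} (hη : F x η = 1) :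
    reverseVector F x η = (2 : ℝ) • w - η := by
  have h1 : navNorm b w η = 1 := by rw [← hF, hη]
  have hη0 : η ≠ 0 := ne_zero_of_navNorm_ne_zero (b := b) (w := w) (by rw [h1]; exact one_ne_zero)
  have hD := hb.navDisc_pos hη0
  have hDF := hb.navDisc_eq η
  have hu : navRel b w η = η - w := by rw [navRel, h1, one_smul]
  have hu0 := hb.navRel_ne_zero hη0
  have hsq := hb.navRel_sq η
  rw [h1] at hsq hDF
  have hleg : innerSL ℝ (-legendre F x η) = -((navDisc b w η)⁻¹ • b (navRel b w η)) := by
    ext z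
    rw [innerSL_apply_eq_sum, ← sum_mul_apply_single]
    refine Finset.sum_congr rfl fun i _ => ?_
    change -(F x η * pd i (fun y' => F x y') η) * z i = _
    rw [hη]
    simp only [hF]
    rw [pd, (hb.hasFDerivAt_navNorm_fiber hη0).fderiv]
    simp
  have hinv : b.inverse (innerSL ℝ (-legendre F x η))
      = -((navDisc b w η)⁻¹ • navRel b w η) := by
    rw [hleg, map_neg, map_smul, hb.isInvertible.inverse_apply_self]
  have hξ : -legendre F x η ≠ 0 := by
    intro h0
    rw [h0] at hinv
    simp [hD.ne', hu0] at hinv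
  have hnorm : √(innerSL ℝ (-legendre F x η) (b.inverse (innerSL ℝ (-legendre F x η))))
      = (navDisc b w η)⁻¹ := by
    rw [hinv, hleg]
    simp only [neg_apply, map_neg, smul_apply, map_smul, smul_eq_mul, hsq]
    rw [one_pow, mul_one, mul_neg, neg_neg, Real.sqrt_mul_self (inv_pos.2 hD).le]
  have hdual : dualMetric F x (-legendre F x η) ≠ 0 := by
    rw [hb.dualMetric_eq hF hξ, hnorm, hleg]
    have h2 := hb.sq_le (navRel b w η) w
    rw [hsq, one_pow, one_mul] at h2
    have h3 := hb.lt_one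
    have h4 : b (navRel b w η) w < 1 := by nlinarith
    simp only [neg_apply, smul_apply, smul_eq_mul]
    have := mul_pos (inv_pos.2 hD) (sub_pos.2 h4)
    linarith
  rw [reverseVector, hb.legendreInv_apply hF hξ, smul_smul, inv_mul_cancel₀ hdual, one_smul, hnorm,
    hinv, inv_inv, smul_neg, smul_smul, mul_inv_cancel₀ hD.ne', one_smul, hu]
  module

end Dual

section Torsion

variable {n : ℕ} {F : E n → E n → ℝ} {b : E n → E n →L[ℝ] E n →L[ℝ] ℝ}
  {b' : E n →L[ℝ] E n →L[ℝ] E n →L[ℝ] ℝ} {w : E n → E n} {a : E n →L[ℝ] E n} {x : E n}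

/-- The reversible torsion vanishes where `L_w b = 0`: in the sum over `η` and `η₋ = 2w - η`, on
which `u` takes opposite values, only `L_w b` survives. -/
theorem NavAt.reversibleTorsion_eq_zero (h : NavAt b b' w a x) (hF : IsRandersAt F b w x)
    (hkill : ∀ v z, navLie (b x) b' (w x) a v z = 0) {η : E n → E n} (hη : DifferentiableAt ℝ η x)
    (h1 : ∀ᶠ z in nhds x, F z (η z) = 1) {X : E n} (hX : fundForm F x (η x) (η x) X = 0) :
    reversibleTorsion F η x X = 0 := by
  have hb := h.self
  have hFη : navNorm (b x) (w x) (η x) = 1 := by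
    rw [← hF.self_of_nhds]; exact h1.self_of_nhds
  have hrev : (fun z => reverseVector F z (η z)) =ᶠ[nhds x] fun z => (2 : ℝ) • w z - η z := by
    filter_upwards [h.nav, hF, h1] with z h2 h3 h4
    exact h2.reverseVector_eq h3 h4
  have hFζ : navNorm (b x) (w x) ((2 : ℝ) • w x - η x) = 1 := by
    rw [hb.navNorm_eq_one_iff] at hFη ⊢
    have : (2 : ℝ) • w x - η x - w x = -(η x - w x) := by module
    rw [this, map_neg, map_neg, neg_apply, neg_neg]
    exact hFη
  have hη0 : η x ≠ 0 :=
    ne_zero_of_navNorm_ne_zero (b := b x) (w := w x) (by rw [hFη]; exact one_ne_zero)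
  have hζ0 : (2 : ℝ) • w x - η x ≠ 0 :=
    ne_zero_of_navNorm_ne_zero (b := b x) (w := w x) (by rw [hFζ]; exact one_ne_zero)
  have hrx : reverseVector F x (η x) = (2 : ℝ) • w x - η x := hrev.self_of_nhds
  have huη : navRel (b x) (w x) (η x) = η x - w x := by rw [navRel, hFη, one_smul]
  have huζ : navRel (b x) (w x) ((2 : ℝ) • w x - η x) = -(η x - w x) := by
    rw [navRel, hFζ]; module
  have hbX : b x (η x - w x) X = 0 := by
    have := h.fundForm_self hF hη0 X
    rw [hX, hFη, huη] at this
    linarith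
  obtain ⟨f₁, c₁, hf₁, hc₁, hg₁⟩ := hb.exists_fiber_deriv (b' := b') (a := a) hη0
  obtain ⟨f₂, c₂, hf₂, hc₂, hg₂⟩ := hb.exists_fiber_deriv (b' := b') (a := a) hζ0
  have hc0 : ∀ y, navCoeff (b x) b' (w x) a y = 0 := fun y => by rw [navCoeff, hkill, zero_div]
  have hf₁X : f₁ X = 0 := by rw [hf₁, huη, smul_apply, hbX, smul_zero]
  have hf₂X : f₂ X = 0 := by rw [hf₂, huζ, smul_apply, map_neg, neg_apply, hbX, neg_zero, smul_zero]
  have hc₁X : c₁ X = 0 := by rw [hc₁, hkill, hkill, hc0]; simp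
  have hc₂X : c₂ X = 0 := by rw [hc₂, hkill, hkill, hc0]; simp
  ext i
  have hco := h.covDeriv_apply hF (X := fun z => reverseVector F z (η z))
    (by rw [hrx]; exact hζ0) X i
  rw [reversibleTorsion, PiLp.add_apply, h.covDeriv_apply hF hη0, hco, hrx]
  obtain ⟨g₁, hg₁, hg₁'⟩ := hg₁ (coordDual (b x) i)
  obtain ⟨g₂, hg₂, hg₂'⟩ := hg₂ (coordDual (b x) i)
  rw [hg₁.fderiv, hg₂.fderiv, hg₁', hg₂', hf₁X, hf₂X, hc₁X, hc₂X, hc0, hc0, hFη, hFζ, huη, huζ]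
  set z := coordDual (b x) i with hz
  have hpd : ∀ j, pd j (fun x' => η x' i) x + pd j (fun x' => reverseVector F x' (η x') i) x
      = 2 * a (EuclideanSpace.single j 1) i := by
    intro j
    have e1 : HasFDerivAt (fun x' => η x' i) _ x :=
      (EuclideanSpace.proj (𝕜 := ℝ) i).hasFDerivAt.comp x hη.hasFDerivAt
    have e2 : HasFDerivAt (fun x' => ((2 : ℝ) • w x' - η x') i) _ x :=
      (EuclideanSpace.proj (𝕜 := ℝ) i).hasFDerivAt.comp x
        ((h.deriv_field.const_smul (2 : ℝ)).fun_sub hη.hasFDerivAt)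
    have e3 : (fun x' => reverseVector F x' (η x') i) =ᶠ[nhds x]
        fun x' => ((2 : ℝ) • w x' - η x') i := hrev.mono fun z hz =>
      congrArg (fun q : E n => q i) hz
    rw [pd_congr e3, pd, pd, e1.fderiv, e2.fderiv]
    simp
  have hsum : ∑ j, X j * pd j (fun x' => η x' i) x
      + ∑ j, X j * pd j (fun x' => reverseVector F x' (η x') i) x = 2 * b x (a X) z := by
    rw [hz, hb.apply_coordDual, ← Finset.sum_add_distrib]
    have := sum_mul_apply_single ((EuclideanSpace.proj (𝕜 := ℝ) i).comp a) X
    simp only [ContinuousLinearMap.comp_apply, PiLp.proj_apply] at this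
    rw [← this, Finset.mul_sum]
    refine Finset.sum_congr rfl fun j _ => ?_
    rw [← mul_add, hpd]; ring
  -- The terms in `±u` cancel; those in `η` and `η₋` add up to the wind terms of `L_w b`.
  have hk := hkill X z
  rw [navLie] at hk
  have e7 : b' ((2 : ℝ) • w x - η x) X z = 2 * b' (w x) X z - b' (η x) X z := by
    simp only [map_sub, map_smul, sub_apply, smul_apply, smul_eq_mul]
  simp only [zero_smul, sub_zero, zero_mul, add_zero, zero_add, one_mul, map_neg, neg_apply, e7,
    PiLp.zero_apply]
  linear_combination hsum + hk

end Torsion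

/-! ### The Busemann–Hausdorff density and the S-curvature -/

section Volume

variable {n : ℕ} {F : E n → E n → ℝ} {b : E n → E n →L[ℝ] E n →L[ℝ] ℝ}
  {b' : E n →L[ℝ] E n →L[ℝ] E n →L[ℝ] ℝ} {w : E n → E n} {a : E n →L[ℝ] E n} {x : E n}

/-- The matrix `h_{ij}` of an inner product. -/
def gram (b : E n →L[ℝ] E n →L[ℝ] ℝ) : Matrix (Fin n) (Fin n) ℝ :=
  Matrix.of fun i j => b (EuclideanSpace.single i 1) (EuclideanSpace.single j 1)

theorem dotProduct_gram_mulVec (b : E n →L[ℝ] E n →L[ℝ] ℝ) (v z : E n) :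
    dotProduct (v : Fin n → ℝ) ((gram b).mulVec z) = b v z := by
  have h1 : ∀ i, (gram b).mulVec z i = b (EuclideanSpace.single i 1) z := fun i =>
    sum_mul_apply_single (b (EuclideanSpace.single i 1)) z
  simp only [dotProduct, h1]
  rw [← ContinuousLinearMap.flip_apply b, ← sum_mul_apply_single (b.flip z) v]
  exact Finset.sum_congr rfl fun i _ => by rw [mul_comm]; rfl

theorem IsNav.posDef_gram {b : E n →L[ℝ] E n →L[ℝ] ℝ} {w : E n} (hb : IsNav b w) :
    (gram b).PosDef := by
  apply Matrix.PosDef.of_dotProduct_mulVec_pos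
  · ext i j
    simp [gram, hb.symm (EuclideanSpace.single i 1) (EuclideanSpace.single j 1)]
  · intro v hv
    have := dotProduct_gram_mulVec b (WithLp.toLp 2 v) (WithLp.toLp 2 v)
    simp only [star_trivial]
    rw [this]
    exact hb.pos _ (by simpa using hv)

open scoped MatrixOrder in
theorem exists_eq_transpose_mul_self {A : Matrix (Fin n) (Fin n) ℝ} (hA : A.PosDef) :
    ∃ B : Matrix (Fin n) (Fin n) ℝ, A = B.transpose * B := by
  obtain ⟨B, hB⟩ := CStarAlgebra.nonneg_iff_eq_star_mul_self.mp hA.posSemidef.nonneg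
  exact ⟨B, by rw [hB, Matrix.star_eq_conjTranspose, Matrix.conjTranspose_eq_transpose_of_trivial]⟩

/-- The Busemann–Hausdorff volume of a Randers metric is the Riemannian volume of `b`, since the
unit balls differ by a translation. -/
theorem IsNav.bhDensity_eq {b : E n →L[ℝ] E n →L[ℝ] ℝ} {w : E n} (hb : IsNav b w)
    (hF : ∀ y, F x y = navNorm b w y) : bhDensity F x = √(gram b).det := by
  obtain ⟨B, hB⟩ := exists_eq_transpose_mul_self hb.posDef_gram
  have hdet : (gram b).det = B.det ^ 2 := by
    rw [hB, Matrix.det_mul, Matrix.det_transpose, sq]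
  have hB0 : B.det ≠ 0 := by
    intro h
    have := hb.posDef_gram.det_pos
    rw [hdet, h] at this
    simp at this
  have hnorm : ∀ y, ‖Matrix.toEuclideanLin B y‖ ^ 2 = b y y := by
    intro y
    rw [← dotProduct_gram_mulVec, hB, ← Matrix.mulVec_mulVec, Matrix.dotProduct_mulVec,
      Matrix.vecMul_transpose, EuclideanSpace.norm_sq_eq]
    simp [dotProduct, sq]
  have hset : {y : E n | F x y < 1}
      = (fun y => y + -w) ⁻¹' (Matrix.toEuclideanLin B ⁻¹' Metric.ball (0 : E n) 1) := by
    ext y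
    simp only [Set.mem_ofPred_eq, Set.mem_preimage, mem_ball_zero_iff]
    rw [hF, hb.navNorm_lt_one_iff, ← sub_eq_add_neg, ← hnorm, sq_lt_one_iff₀ (norm_nonneg _)]
  have hL : LinearMap.det (Matrix.toEuclideanLin B) = B.det := LinearMap.det_toLpLin _ _
  rw [bhDensity, hset, MeasureTheory.measure_preimage_add_right,
    MeasureTheory.Measure.addHaar_preimage_linearMap _ (by rw [hL]; exact hB0), hL,
    ENNReal.toReal_mul, ENNReal.toReal_ofReal (abs_nonneg _), hdet, Real.sqrt_sq_eq_abs, abs_inv]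
  have hball : (MeasureTheory.volume (Metric.ball (0 : E n) 1)).toReal ≠ 0 :=
    (ENNReal.toReal_pos (Metric.measure_ball_pos _ _ one_pos).ne'
      MeasureTheory.measure_ball_lt_top.ne).ne'
  have := abs_ne_zero.2 hB0
  field_simp

theorem differentiable_det :
    Differentiable ℝ (fun A : Fin n → Fin n → ℝ => (Matrix.of A).det) := by
  simp only [Matrix.det_apply, Matrix.of_apply]
  fun_prop

/-- The derivative of the determinant at the identity matrix is the trace. -/
theorem fderiv_det_one (M : Fin n → Fin n → ℝ) :
    fderiv ℝ (fun A : Fin n → Fin n → ℝ => (Matrix.of A).det)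
      (fun i j => (1 : Matrix (Fin n) (Fin n) ℝ) i j) M = ∑ i, M i i := by
  set I : Fin n → Fin n → ℝ := fun i j => (1 : Matrix (Fin n) (Fin n) ℝ) i j
  have h1 : HasDerivAt (fun r : ℝ => I + r • M) M 0 := by
    simpa using ((hasDerivAt_id (0 : ℝ)).smul_const M).const_add I
  have h2 := (differentiable_det (n := n) (I + (0 : ℝ) • M)).hasFDerivAt.comp_hasDerivAt 0 h1
  rw [zero_smul, add_zero] at h2
  obtain ⟨p, hp⟩ : ∃ p : Polynomial ℝ, ∀ r : ℝ, (Matrix.of (I + r • M)).det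
      = 1 + (∑ i, M i i) * r + p.eval r * r ^ 2 :=
    ⟨_, fun r => Matrix.det_one_add_smul r (Matrix.of M)⟩
  have h3 : HasDerivAt (fun r : ℝ => 1 + (∑ i, M i i) * r + p.eval r * r ^ 2) (∑ i, M i i) 0 := by
    have := (((hasDerivAt_id (0 : ℝ)).const_mul (∑ i, M i i)).const_add 1).fun_add
      ((p.hasDerivAt 0).fun_mul (hasDerivAt_pow 2 (0 : ℝ)))
    simpa using this
  refine h2.unique (h3.congr_of_eventuallyEq ?_)
  exact Filter.Eventually.of_forall hp

/-- Jacobi's formula for the logarithm of the determinant of the metric. -/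
theorem NavAt.hasFDerivAt_log_det (h : NavAt b b' w a x) :
    ∃ l : E n →L[ℝ] ℝ, HasFDerivAt (fun x' => Real.log (gram (b x')).det) l x ∧
      ∀ v, l v = ∑ i, b' v (coordDual (b x) i) (EuclideanSpace.single i 1) := by
  have hb := h.self
  -- Multiplying by the inverse matrix at `x` reduces the claim to the derivative of `det` at `1`.
  set Z : Matrix (Fin n) (Fin n) ℝ := Matrix.of fun i j => coordDual (b x) i j with hZ
  have hmul : ∀ c : E n →L[ℝ] E n →L[ℝ] ℝ, Z * gram c
      = Matrix.of fun i j => c (coordDual (b x) i) (EuclideanSpace.single j 1) := by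
    intro c
    ext i j
    rw [Matrix.mul_apply, Matrix.of_apply, ← ContinuousLinearMap.flip_apply c,
      ← sum_mul_apply_single _ (coordDual (b x) i)]
    exact Finset.sum_congr rfl fun k _ => mul_comm _ _
  have hone : Z * gram (b x) = 1 := by
    rw [hmul]
    ext i j
    rw [Matrix.of_apply, hb.symm, hb.apply_coordDual]
    simp [Matrix.one_apply]
  have hdet := congrArg Matrix.det hone
  rw [Matrix.det_mul, Matrix.det_one] at hdet
  have hZ0 : Z.det ≠ 0 := left_ne_zero_of_mul_eq_one hdet
  have hK : HasFDerivAt (fun x' => fun i j : Fin n =>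
      b x' (coordDual (b x) i) (EuclideanSpace.single j 1))
      (ContinuousLinearMap.pi fun i => ContinuousLinearMap.pi fun j =>
        (b'.flip (coordDual (b x) i)).flip (EuclideanSpace.single j 1)) x := by
    rw [hasFDerivAt_pi]
    intro i
    rw [hasFDerivAt_pi]
    intro j
    convert (h.deriv_metric.clm_apply (hasFDerivAt_const (coordDual (b x) i) x)).clm_apply
      (hasFDerivAt_const (EuclideanSpace.single j (1 : ℝ)) x) using 1
    ext v
    simp
  have hKx : (fun i j : Fin n => b x (coordDual (b x) i) (EuclideanSpace.single j 1))
      = (1 : Matrix (Fin n) (Fin n) ℝ) := by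
    rw [← hone, hmul]; rfl
  have hD := (differentiable_det (n := n) (fun i j : Fin n =>
    b x (coordDual (b x) i) (EuclideanSpace.single j 1))).hasFDerivAt.comp x hK
  have hlog := (hD.log (by
    simp only [Function.comp_apply, hKx]
    exact Matrix.det_one.trans_ne one_ne_zero)).sub_const (Real.log Z.det)
  refine ⟨_, hlog.congr_of_eventuallyEq ?_, fun v => ?_⟩
  · filter_upwards [h.nav] with x' hx'
    have h1 : (Z * gram (b x')).det = Z.det * (gram (b x')).det := Matrix.det_mul _ _
    rw [hmul] at h1
    simp only [Function.comp_apply]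
    rw [h1, Real.log_mul hZ0 hx'.posDef_gram.det_pos.ne']
    ring
  · simp only [Function.comp_apply, hKx]
    have := fderiv_det_one (fun i j : Fin n =>
      b' v (coordDual (b x) i) (EuclideanSpace.single j 1))
    have h1 : (Matrix.of (1 : Matrix (Fin n) (Fin n) ℝ)).det = 1 := Matrix.det_one
    rw [h1, ← this]
    simp

/-- The traces of `∂_y b` in the divergence of the spray and in the derivative of the density
cancel. -/
theorem NavAt.sCurvature_eq (h : NavAt b b' w a x) (hF : IsRandersAt F b w x) {y : E n}
    (hy : y ≠ 0) :
    sCurvature F (bhDensity F) x y = -((n + 1) / 2 * navCoeff (b x) b' (w x) a y) := by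
  have hb := h.self
  obtain ⟨l, hl, hl'⟩ := h.hasFDerivAt_log_det
  have h1 : (fun x' => Real.log (bhDensity F x')) =ᶠ[nhds x]
      fun x' => 1 / 2 * Real.log (gram (b x')).det := by
    filter_upwards [h.nav, hF] with x' hx' hx''
    rw [hx'.bhDensity_eq hx'', Real.log_sqrt hx'.posDef_gram.det_pos.le]
    ring
  have h2 : ∀ i, pd i (fun y' => geodesicCoeff F x y' i) y
      = pd i (fun y' => navSpray (b x) b' (w x) a y' i) y := by
    intro i
    apply pd_congr
    filter_upwards [isOpen_ne.mem_nhds hy] with y' hy'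
    exact h.geodesicCoeff_eq hF hy' i
  have h3 : ∑ i, y i * pd i (fun x' => Real.log (bhDensity F x')) x = 1 / 2 * l y := by
    rw [← sum_mul_apply_single l y, Finset.mul_sum]
    refine Finset.sum_congr rfl fun i _ => ?_
    rw [pd_congr h1, pd, (hl.const_mul (1 / 2)).fderiv]
    simp
    ring
  rw [sCurvature, h3, Finset.sum_congr rfl fun i _ => h2 i, hb.sum_pd_navSpray hy h.symm', hl',
    hb.sum_coordDual_flip (b' y)]
  ring

/-- All `u ≠ 0` are of the form `y - F(y) w`, so that `c = 0` in all directions means that the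
symmetric form `L_w b` vanishes on the diagonal. -/
theorem IsNav.navCoeff_eq_zero_iff {V : Type*} [NormedAddCommGroup V] [NormedSpace ℝ V]
    {b : V →L[ℝ] V →L[ℝ] ℝ} {b' : V →L[ℝ] V →L[ℝ] V →L[ℝ] ℝ} {w : V} {a : V →L[ℝ] V}
    (hb : IsNav b w) (hsymm : ∀ q v z, b' q v z = b' q z v) :
    (∀ y ≠ 0, navCoeff b b' w a y = 0) ↔ ∀ v z, navLie b b' w a v z = 0 := by
  constructor
  · intro h
    have hdiag : ∀ u, navLie b b' w a u u = 0 := by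
      intro u
      by_cases hu : u = 0
      · simp [hu, navLie]
      -- `u` is the vector `y - F(y) w` for `y = u + |u| w`.
      have hr := Real.sqrt_pos.2 (hb.pos u hu)
      set r := √(b u u)
      have hF : navNorm b w (u + r • w) = r := by
        rw [hb.navNorm_eq_iff _ hr, add_sub_cancel_right, Real.sq_sqrt (hb.nonneg u)]
      have hy : u + r • w ≠ 0 :=
        ne_zero_of_navNorm_ne_zero (b := b) (w := w) (by rw [hF]; exact hr.ne')
      have h1 := h _ hy
      rw [navCoeff, navRel, hF, add_sub_cancel_right, div_eq_zero_iff] at h1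
      exact h1.resolve_right (by positivity)
    intro v z
    have h1 := hdiag (v + z)
    have h2 := hdiag v
    have h3 := hdiag z
    simp only [navLie, map_add, add_apply] at h1 h2 h3 ⊢
    rw [hsymm w z v, hb.symm (a z) v, hb.symm z (a v)] at h1
    linarith
  · intro h y _
    rw [navCoeff, h, zero_div]

end Volume

/-! ### Vector fields and metrics in charts -/

section Chart

variable {n : ℕ} {M : Type*} [TopologicalSpace M] [ChartedSpace (E n) M]
  {e : OpenPartialHomeomorph M (E n)}

theorem mdifferentiable_of_mem_maximalAtlas (he : e ∈ IsManifold.maximalAtlas (𝓡 n) ∞ M) :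
    e.MDifferentiable (𝓡 n) (𝓡 n) :=
  ⟨(contMDiffOn_of_mem_maximalAtlas he).mdifferentiableOn (by simp),
    (contMDiffOn_symm_of_mem_maximalAtlas he).mdifferentiableOn (by simp)⟩

theorem contMDiffAt_symm_of_mem_target (he : e ∈ IsManifold.maximalAtlas (𝓡 n) ∞ M) {u : E n}
    (hu : u ∈ e.target) : ContMDiffAt (𝓡 n) (𝓡 n) ∞ e.symm u :=
  (contMDiffOn_symm_of_mem_maximalAtlas he).contMDiffAt (e.open_target.mem_nhds hu)

theorem toCoord_ofCoord (he : e ∈ IsManifold.maximalAtlas (𝓡 n) ∞ M) {u : E n}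
    (hu : u ∈ e.target) (y : E n) : toCoord e (e.symm u) (ofCoord e u y) = y :=
  DFunLike.congr_fun ((mdifferentiable_of_mem_maximalAtlas he).comp_symm_deriv hu) y

theorem ofCoord_toCoord (he : e ∈ IsManifold.maximalAtlas (𝓡 n) ∞ M) {u : E n}
    (hu : u ∈ e.target) (X : TangentSpace (𝓡 n) (e.symm u)) :
    ofCoord e u (toCoord e (e.symm u) X) = X := by
  have h := (mdifferentiable_of_mem_maximalAtlas he).symm_comp_deriv (e.map_target hu)
  rw [e.right_inv hu] at h
  exact DFunLike.congr_fun h X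

theorem isInvertible_mfderiv_symm (he : e ∈ IsManifold.maximalAtlas (𝓡 n) ∞ M) {u : E n}
    (hu : u ∈ e.target) : (mfderiv (𝓡 n) (𝓡 n) e.symm u).IsInvertible :=
  ⟨(mdifferentiable_of_mem_maximalAtlas he).symm.mfderiv hu, rfl⟩

theorem localField_eq_mpullback (he : e ∈ IsManifold.maximalAtlas (𝓡 n) ∞ M) {u : E n}
    (hu : u ∈ e.target) (V : ∀ x : M, TangentSpace (𝓡 n) x) :
    localField V e u = VectorField.mpullback (𝓡 n) (𝓡 n) e.symm V u := by
  rw [VectorField.mpullback_apply]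
  symm
  refine ((isInvertible_mfderiv_symm he hu).inverse_apply_eq).2 ?_
  exact (ofCoord_toCoord he hu _).symm

variable [IsManifold (𝓡 n) ∞ M]

/-- In a chart a vector field is its pullback under `e.symm`, which reduces the claim to Mathlib's
differentiability of pulled back fields. -/
theorem differentiableAt_localField (he : e ∈ IsManifold.maximalAtlas (𝓡 n) ∞ M) {u : E n}
    (hu : u ∈ e.target) {V : ∀ x : M, TangentSpace (𝓡 n) x}
    (hV : MDifferentiableAt (𝓡 n) (𝓡 n).tangent
      (fun x => (⟨x, V x⟩ : TangentBundle (𝓡 n) M)) (e.symm u)) :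
    DifferentiableAt ℝ (localField V e) u := by
  have : IsManifold (𝓡 n) 2 M := inferInstance
  have h1 := MDifferentiableAt.mpullback_vectorField (n := ∞) hV
    (contMDiffAt_symm_of_mem_target he hu) (isInvertible_mfderiv_symm he hu) ENat.LEInfty.out
  have h2 := (contMDiff_snd_tangentBundle_modelSpace (n := 1) (E n)
    (𝓡 n)).contMDiffAt.mdifferentiableAt one_ne_zero |>.comp _ h1
  have h3 : DifferentiableAt ℝ (VectorField.mpullback (𝓡 n) (𝓡 n) e.symm V) u :=
    mdifferentiableAt_iff_differentiableAt.1 h2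
  refine h3.congr_of_eventuallyEq ?_
  filter_upwards [e.open_target.mem_nhds hu] with z hz
  exact localField_eq_mpullback he hz V

/-- The components `h_{ij}` are the metric applied to the coordinate vector fields, both being
differentiable sections. -/
theorem differentiableAt_localRiem
    (h : Bundle.ContMDiffRiemannianMetric (𝓡 n) ∞ (E n) (fun x : M => TangentSpace (𝓡 n) x))
    (he : e ∈ IsManifold.maximalAtlas (𝓡 n) ∞ M) {u : E n} (hu : u ∈ e.target) (i j : Fin n) :
    DifferentiableAt ℝ (localRiem h e i j) u := by
  have hsymm := contMDiffAt_symm_of_mem_target he hu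
  have hvec : ∀ v : E n, MDifferentiableAt (𝓡 n) (𝓡 n).tangent
      (fun z => (⟨e.symm z, ofCoord e z v⟩ : TangentBundle (𝓡 n) M)) u := by
    intro v
    have h1 : ContMDiffOn (𝓡 n).tangent (𝓡 n).tangent 1
        (tangentMapWithin (𝓡 n) (𝓡 n) e.symm e.target) _ :=
      (contMDiffOn_symm_of_mem_maximalAtlas he).contMDiffOn_tangentMapWithin
        (one_add_one_eq_two.trans_le ENat.LEInfty.out)
        e.open_target.uniqueMDiffOn
    have h2 : ContMDiff (𝓡 n) (𝓡 n).tangent 1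
        (fun z : E n => (⟨z, v⟩ : TangentBundle (𝓡 n) (E n))) :=
      contMDiff_vectorSpace_iff_contDiff.2 contDiff_const
    have h3 := (h1.comp h2.contMDiffOn (s := e.target) fun z hz => hz).mdifferentiableOn one_ne_zero
    refine (h3.mdifferentiableAt (e.open_target.mem_nhds hu)).congr_of_eventuallyEq ?_
    filter_upwards [e.open_target.mem_nhds hu] with z hz
    simp only [Function.comp_apply, tangentMapWithin, ofCoord,
      mfderivWithin_of_isOpen e.open_target hz]
  have h1 : MDifferentiableAt (𝓡 n) ((𝓡 n).prod 𝓘(ℝ, E n →L[ℝ] E n →L[ℝ] ℝ))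
      (fun z => Bundle.TotalSpace.mk' (E n →L[ℝ] E n →L[ℝ] ℝ)
        (E := fun x : M => TangentSpace (𝓡 n) x →L[ℝ] TangentSpace (𝓡 n) x →L[ℝ] ℝ)
        (e.symm z) (h.inner (e.symm z))) u :=
    ((h.contMDiff.contMDiffAt.mdifferentiableAt (by simp))).comp u
      (hsymm.mdifferentiableAt (by simp))
  have h2 := MDifferentiableAt.clm_bundle_apply₂ (E₃ := Bundle.Trivial M ℝ) (F₃ := ℝ) h1
    (hvec (EuclideanSpace.single i 1)) (hvec (EuclideanSpace.single j 1))
  rw [mdifferentiableAt_totalSpace] at h2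
  exact mdifferentiableAt_iff_differentiableAt.1 h2.2

end Chart

/-! ### Randers metrics on manifolds -/

section Chart

variable {n : ℕ} {M : Type*} [TopologicalSpace M] [ChartedSpace (E n) M]
  [IsManifold (𝓡 n) ∞ M] {e : OpenPartialHomeomorph M (E n)}

/-- The components of a Riemannian metric in the chart `e`, assembled into a bilinear form on
`ℝⁿ`. It is a finite sum of constant forms with coefficients `h_{ij}`, which makes its
differentiability that of the `h_{ij}`. -/
def localForm
    (h : Bundle.ContMDiffRiemannianMetric (𝓡 n) ∞ (E n) (fun x : M => TangentSpace (𝓡 n) x))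
    (e : OpenPartialHomeomorph M (E n)) (u : E n) : E n →L[ℝ] E n →L[ℝ] ℝ :=
  ∑ i, ∑ j, localRiem h e i j u •
    (EuclideanSpace.proj i : E n →L[ℝ] ℝ).smulRight (EuclideanSpace.proj j : E n →L[ℝ] ℝ)

theorem localForm_apply
    (h : Bundle.ContMDiffRiemannianMetric (𝓡 n) ∞ (E n) (fun x : M => TangentSpace (𝓡 n) x))
    (u v z : E n) :
    localForm h e u v z = h.inner (e.symm u) (ofCoord e u v) (ofCoord e u z) := by
  have h1 : ∀ v : E n, ofCoord e u v
      = ∑ k, v k • ofCoord e u (EuclideanSpace.single k (1 : ℝ)) := by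
    intro v
    change mfderiv (𝓡 n) (𝓡 n) e.symm u v = _
    conv_lhs => rw [← sum_smul_single v]
    refine (map_sum (mfderiv (𝓡 n) (𝓡 n) e.symm u) _ _).trans ?_
    exact Finset.sum_congr rfl fun k _ => map_smul (mfderiv (𝓡 n) (𝓡 n) e.symm u) _ _
  rw [h1 v, h1 z]
  simp only [localForm, map_sum, map_smul, sum_apply, smul_apply, smul_eq_mul, Finset.mul_sum,
    ContinuousLinearMap.smulRight_apply, PiLp.proj_apply, localRiem]
  rw [Finset.sum_comm]
  refine Finset.sum_congr rfl fun j _ => Finset.sum_congr rfl fun i _ => ?_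
  ring

theorem localForm_single
    (h : Bundle.ContMDiffRiemannianMetric (𝓡 n) ∞ (E n) (fun x : M => TangentSpace (𝓡 n) x))
    (u : E n) (i j : Fin n) :
    localForm h e u (EuclideanSpace.single i 1) (EuclideanSpace.single j 1)
      = localRiem h e i j u :=
  localForm_apply h u _ _

theorem NavigationData.isNav_localForm (D : NavigationData n M)
    (he : e ∈ IsManifold.maximalAtlas (𝓡 n) ∞ M) {u : E n} (hu : u ∈ e.target) :
    IsNav (localForm D.h e u) (localField D.W e u) where
  symm v z := by rw [localForm_apply, localForm_apply, D.h.symm]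
  pos v hv := by
    rw [localForm_apply]
    apply D.h.pos
    intro h0
    apply hv
    rw [← toCoord_ofCoord he hu v, h0]
    exact map_zero (mfderiv (𝓡 n) (𝓡 n) e (e.symm u))
  lt_one := by
    rw [localForm_apply]
    have : ofCoord e u (localField D.W e u) = D.W (e.symm u) := ofCoord_toCoord he hu _
    rw [this]
    exact D.norm_W_lt _

/-- In a chart the Randers metric is the Randers norm of the components of the navigation data. -/
theorem NavigationData.localMetric_eq (D : NavigationData n M)
    (he : e ∈ IsManifold.maximalAtlas (𝓡 n) ∞ M) {u : E n} (hu : u ∈ e.target) (y : E n) :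
    localMetric D.randers e u y = navNorm (localForm D.h e u) (localField D.W e u) y := by
  have : ofCoord e u (localField D.W e u) = D.W (e.symm u) := ofCoord_toCoord he hu _
  rw [navNorm, navDisc, localForm_apply, localForm_apply, localForm_apply, this]
  rfl

theorem NavigationData.isRandersAt (D : NavigationData n M)
    (he : e ∈ IsManifold.maximalAtlas (𝓡 n) ∞ M) {u : E n} (hu : u ∈ e.target) :
    IsRandersAt (localMetric D.randers e) (localForm D.h e) (localField D.W e) u := by
  filter_upwards [e.open_target.mem_nhds hu] with z hz y
  exact D.localMetric_eq he hz y

theorem differentiableAt_sum_smul {ι E₁ F₁ : Type*} [Fintype ι] [NormedAddCommGroup E₁]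
    [NormedSpace ℝ E₁] [NormedAddCommGroup F₁] [NormedSpace ℝ F₁] {c : ι → ι → E₁ → ℝ} {x : E₁}
    (hc : ∀ i j, DifferentiableAt ℝ (c i j) x) (T : ι → ι → F₁) :
    DifferentiableAt ℝ (fun z => ∑ i, ∑ j, c i j z • T i j) x :=
  DifferentiableAt.fun_sum fun i _ => DifferentiableAt.fun_sum fun j _ => (hc i j).smul_const _

theorem NavigationData.differentiableAt_localForm (D : NavigationData n M)
    (he : e ∈ IsManifold.maximalAtlas (𝓡 n) ∞ M) {u : E n} (hu : u ∈ e.target) :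
    DifferentiableAt ℝ (localForm D.h e) u := by
  have := differentiableAt_sum_smul (F₁ := E n →L[ℝ] E n →L[ℝ] ℝ)
    (differentiableAt_localRiem D.h he hu) fun i j =>
      (EuclideanSpace.proj i : E n →L[ℝ] ℝ).smulRight (EuclideanSpace.proj j : E n →L[ℝ] ℝ)
  exact this

theorem NavigationData.differentiableAt_localField (D : NavigationData n M)
    (he : e ∈ IsManifold.maximalAtlas (𝓡 n) ∞ M) {u : E n} (hu : u ∈ e.target) :
    DifferentiableAt ℝ (localField D.W e) u :=
  Finsler.differentiableAt_localField he hu (D.smooth_W.contMDiffAt.mdifferentiableAt (by simp))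

theorem NavigationData.navAt (D : NavigationData n M)
    (he : e ∈ IsManifold.maximalAtlas (𝓡 n) ∞ M) {u : E n} (hu : u ∈ e.target) :
    NavAt (localForm D.h e) (fderiv ℝ (localForm D.h e) u) (localField D.W e)
      (fderiv ℝ (localField D.W e) u) u where
  nav := by
    filter_upwards [e.open_target.mem_nhds hu] with z hz
    exact D.isNav_localForm he hz
  deriv_metric := (D.differentiableAt_localForm he hu).hasFDerivAt
  deriv_field := (D.differentiableAt_localField he hu).hasFDerivAt

/-- The Lie derivative of the metric along the wind in the chart `e`. -/
def NavigationData.localLie (D : NavigationData n M) (e : OpenPartialHomeomorph M (E n)) (u : E n) :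
    E n → E n → ℝ :=
  navLie (localForm D.h e u) (fderiv ℝ (localForm D.h e) u) (localField D.W e u)
    (fderiv ℝ (localField D.W e) u)

theorem NavigationData.localLie_single (D : NavigationData n M)
    (he : e ∈ IsManifold.maximalAtlas (𝓡 n) ∞ M) {u : E n} (hu : u ∈ e.target) (i j : Fin n) :
    D.localLie e u (EuclideanSpace.single i 1) (EuclideanSpace.single j 1)
      = ∑ k, (localField D.W e u k * pd k (localRiem D.h e i j) u
      + localRiem D.h e k j u * pd i (fun u' => localField D.W e u' k) u
      + localRiem D.h e i k u * pd j (fun u' => localField D.W e u' k) u) := by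
  have hn := D.navAt he hu
  have h1 : ∀ k, pd k (localRiem D.h e i j) u = fderiv ℝ (localForm D.h e) u
      (EuclideanSpace.single k 1) (EuclideanSpace.single i 1) (EuclideanSpace.single j 1) := by
    intro k
    have h2 := (hn.deriv_metric.clm_apply (hasFDerivAt_const
      (EuclideanSpace.single i (1 : ℝ)) u)).clm_apply
      (hasFDerivAt_const (EuclideanSpace.single j (1 : ℝ)) u)
    simp only [localForm_single] at h2
    have h3 : fderiv ℝ (localRiem D.h e i j) u = _ := h2.fderiv
    rw [pd, h3]
    simp
  have h2 : ∀ i k, pd i (fun u' => localField D.W e u' k) u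
      = fderiv ℝ (localField D.W e) u (EuclideanSpace.single i 1) k := by
    intro i k
    have h3 : HasFDerivAt (fun u' => localField D.W e u' k) _ u :=
      (EuclideanSpace.proj (𝕜 := ℝ) k).hasFDerivAt.comp u hn.deriv_field
    rw [pd, h3.fderiv]
    rfl
  simp only [h1, h2, Finset.sum_add_distrib]
  rw [localLie, navLie]
  congr 1
  · congr 1
    · have := sum_mul_apply_single (((fderiv ℝ (localForm D.h e) u).flip
        (EuclideanSpace.single i 1)).flip (EuclideanSpace.single j 1)) (localField D.W e u)
      simp only [ContinuousLinearMap.flip_apply] at this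
      rw [← this]
      exact Finset.sum_congr rfl fun k _ => mul_comm _ _
    · have := sum_mul_apply_single ((localForm D.h e u).flip (EuclideanSpace.single j 1))
        (fderiv ℝ (localField D.W e) u (EuclideanSpace.single i 1))
      simp only [ContinuousLinearMap.flip_apply, localForm_single] at this
      exact this.symm
  · have := sum_mul_apply_single (localForm D.h e u (EuclideanSpace.single i 1))
        (fderiv ℝ (localField D.W e) u (EuclideanSpace.single j 1))
    simp only [localForm_single] at this
    exact this.symm

theorem NavigationData.isKilling_iff (D : NavigationData n M) :
    IsKilling D.h D.W ↔ ∀ e ∈ IsManifold.maximalAtlas (𝓡 n) ∞ M, ∀ u ∈ e.target,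
      ∀ v z, D.localLie e u v z = 0 := by
  refine forall₂_congr fun e he => forall₂_congr fun u hu => ?_
  constructor
  · intro h v z
    have h0 : ∀ i j, D.localLie e u (EuclideanSpace.single i 1) (EuclideanSpace.single j 1) = 0 :=
      fun i j => by rw [D.localLie_single he hu, h]
    obtain ⟨T, hT⟩ : ∃ T : E n →L[ℝ] E n →L[ℝ] ℝ, ∀ v z, D.localLie e u v z = T v z :=
      ⟨fderiv ℝ (localForm D.h e) u (localField D.W e u)
        + (localForm D.h e u).comp (fderiv ℝ (localField D.W e) u)
        + ((localForm D.h e u).flip.comp (fderiv ℝ (localField D.W e) u)).flip, fun _ _ => rfl⟩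
    simp only [hT] at h0 ⊢
    rw [← sum_mul_apply_single (T v) z]
    refine Finset.sum_eq_zero fun j _ => ?_
    rw [← ContinuousLinearMap.flip_apply T, ← sum_mul_apply_single _ v]
    simp [h0]
  · intro h i j
    rw [← D.localLie_single he hu, h]

theorem NavigationData.sCurvatureVanishes_iff (D : NavigationData n M) :
    SCurvatureVanishes D.randers ↔ ∀ e ∈ IsManifold.maximalAtlas (𝓡 n) ∞ M, ∀ u ∈ e.target,
      ∀ v z, D.localLie e u v z = 0 := by
  refine forall₂_congr fun e he => ?_
  have key : ∀ u ∈ e.target, (∀ v z, D.localLie e u v z = 0) ↔ ∀ y : E n, y ≠ 0 →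
      sCurvature (localMetric D.randers e) (bhDensity (localMetric D.randers e)) u y = 0 := by
    intro u hu
    have hn := D.navAt he hu
    refine (hn.self.navCoeff_eq_zero_iff hn.symm').symm.trans (forall₂_congr fun y hy => ?_)
    have hpos : ((n : ℝ) + 1) / 2 ≠ 0 := by positivity
    rw [hn.sCurvature_eq (D.isRandersAt he hu) hy, neg_eq_zero, mul_eq_zero, or_iff_right hpos]
  constructor
  · intro h u hu
    rw [key u hu]
    intro y hy
    have h1 := h (e.symm u) (e.map_target hu) (ofCoord e u y) (fun h0 => hy ?_)
    · rwa [e.right_inv hu, toCoord_ofCoord he hu] at h1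
    · rw [← toCoord_ofCoord he hu y, h0]
      exact map_zero (mfderiv (𝓡 n) (𝓡 n) e (e.symm u))
  · intro h x hx y hy
    refine (key _ (e.map_source hx)).1 (h _ (e.map_source hx)) _ fun h0 => hy ?_
    have h1 := DFunLike.congr_fun ((mdifferentiable_of_mem_maximalAtlas he).symm_comp_deriv hx) y
    refine h1.symm.trans ?_
    change mfderiv (𝓡 n) (𝓡 n) e.symm (e x) (toCoord e x y) = 0
    rw [h0]
    exact map_zero (mfderiv (𝓡 n) (𝓡 n) e.symm (e x))

theorem NavigationData.reversibleTorsionVanishes (D : NavigationData n M)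
    (hD : ∀ e ∈ IsManifold.maximalAtlas (𝓡 n) ∞ M, ∀ u ∈ e.target, ∀ v z, D.localLie e u v z = 0) :
    ReversibleTorsionVanishes D.randers := by
  intro x U hU hxU η hη hη1 e he hx X hX
  have hu := e.map_source hx
  have hηx : MDifferentiableAt (𝓡 n) (𝓡 n).tangent
      (fun z => (⟨z, η z⟩ : TangentBundle (𝓡 n) M)) (e.symm (e x)) := by
    rw [e.left_inv hx]
    exact hη.mdifferentiableAt (hU.mem_nhds hxU)
  have h1 : ∀ᶠ z in nhds (e x), localMetric D.randers e z (localField η e z) = 1 := by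
    have hUe : ∀ᶠ z in nhds (e x), e.symm z ∈ U :=
      (e.continuousAt_symm hu).preimage_mem_nhds (by
        rw [e.left_inv hx]; exact hU.mem_nhds hxU)
    filter_upwards [e.open_target.mem_nhds hu, hUe] with z hz hz'
    have : ofCoord e z (localField η e z) = η (e.symm z) := ofCoord_toCoord he hz _
    rw [localMetric, this]
    exact hη1 _ hz'
  refine (D.navAt he hu).reversibleTorsion_eq_zero (D.isRandersAt he hu) (hD e he _ hu)
    (Finsler.differentiableAt_localField he hu hηx) h1 ?_
  have h2 : localField η e (e x) = toCoord e x (η x) := by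
    rw [localField, e.left_inv hx]
  rw [h2]
  exact hX

end Chart

end Finsler

end

theorem lemma5p1 {n : ℕ} {M : Type*} [TopologicalSpace M] [ChartedSpace (Finsler.E n) M]
    [IsManifold (𝓡 n) ∞ M] (D : Finsler.NavigationData n M) :
    (Finsler.SCurvatureVanishes D.randers ↔ Finsler.IsKilling D.h D.W) ∧
      (Finsler.SCurvatureVanishes D.randers → Finsler.ReversibleTorsionVanishes D.randers) :=
  ⟨D.sCurvatureVanishes_iff.trans D.isKilling_iff.symm,
    fun h => D.reversibleTorsionVanishes (D.sCurvatureVanishes_iff.1 h)⟩
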